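/- **Setting.** Fix real numbers $a_0,a_2,b_0,b_2,\ell>0$, $c_0,c_2\ge 0$ with $a_2b_0-a_0b_2\ne 0$, put $\beta_0=\frac{a_0+b_0}{2a_0}$ and $\beta_2=\frac{a_2+b_2}{2b_2}$, and assume $\frac12<\beta_0<2<\beta_2$. Consider the neutral vector field (without higher order terms) $$\dot x=x(a_0x^2+a_2z^2),\qquad \dot y=-\ell y(1+c_0x^2+c_2z^2),\qquad \dot z=-z(b_0x^2+b_2z^2).$$ For $0<|x|\le 1$ let $\tau'(x,y)$ be the first time $t\ge 0$ at which the orbit of $(x,y,1)$ reaches $\{|x|=1\}$, and let $D_1(x,y)$ be the point reached. Let $1<a\le 2$, let $P_2(1,y,z)=(az-1,\,y-\frac12)$ and $P_2(-1,y,z)=(1-az,\,y+\frac12)$, and let $P_{\rm Neu}=P_2\circ D_1$. Its first coordinate depends on $x$ only and defines the Lorenz-like map $f=f_{\rm Neu}$ on $[-1,1]\setminus\{0\}$. Let $\tau_2:[-1,1]\setminus\{0\}\to(0,\infty)$ be Hölder continuous with exponent $\epsilon\in(0,1]$ on each of $[-1,0)$ and $(0,1]$. Put $r_{\rm Neu}(x,y)=\tau'(x,y)+\tau_2(x)$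 and $r^{(k)}_{\rm Neu}=\sum_{i=0}^{k-1}r_{\rm Neu}\circ P_{\rm Neu}^i$. For $\sigma\in(0,1)$ and $c,\delta>0$, an integer $n\ge1$ is a *hyperbolic time* of $x$ if for all $1\le k\le n$ $$\prod_{j=n-k}^{n-1}|f'(f^jx)|\ge\sigma^{-k}\quad\text{and}\quad d_\delta(f^{n-k}x)\ge\sigma^{ck},$$ where $d_\delta(u)=|u|$ if $|u|<\delta$ and $d_\delta(u)=1$ otherwise. Let $\tilde F=f^\tau$ be an inducing scheme by hyperbolic times: $\tilde X\subset[-1,1]$ is an open interval containing $0$; $\tilde{\mathcal Q}$ is a countable family of disjoint open subintervals covering $\tilde X$ up to a Lebesgue null set; $\tau$ is a positive integer valued function, constant on the elements of $\tilde{\mathcal Q}$; $\tilde F$ maps each $\tilde Q\in\tilde{\mathcal Q}$ bijectively onto $\tilde X$, is $C^2$ on $\tilde Q$, and there are $\kappa>1$ and $K$ with $|\tilde F'|\ge\kappa$ on every $\tilde Q$ and $|\tilde F'(x)|\le K|\tilde F'(y)|$ for $x,y$ in the same $\tilde Q$; and there are $\sigma\in(0,1)$, $c\in(0,\frac23]$,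 $\delta,\delta_0>0$ and $N\in\mathbb N$ such that on each $\tilde Q$ one has $\tau=n+m$ with $0\le m\le N$, where $n$ is a hyperbolic time of every $x\in\tilde Q$ (for these $\sigma,c,\delta$) and $|f^i(x)|\ge\delta_0$ for all $x\in\tilde Q$ and $n\le i<n+m$. On $\bigcup\tilde{\mathcal Q}$, let $s(x,y)$ be the least $n\ge0$ such that $\tilde F^nx$ and $\tilde F^ny$ do not lie in a common element of $\tilde{\mathcal Q}$ ($s=\infty$ if there is none), let $d_\eta(x,y)=\eta^{s(x,y)}$ (with $\eta^\infty=0$) for $0<\eta<1$, and let $R(x)=r^{(\tau(x))}_{\rm Neu}(x,0)$ be the quotient induced roof function. **Proposition.** There is $B>0$ such that for all $x,y$ with $s(x,y)\ge1$, all heights $u,v\in[-1,1]$ and all $0\le k\le\tau(x)=\tau(y)$, $$|r^{(k)}_{\rm Neu}(x,u)-r^{(k)}_{\rm Neu}(y,v)|\le B\,|\tilde F(x)-\tilde F(y)|^{\epsilon}$$ (in particular $r^{(k)}_{\rm Neu}$, $0\le k\le\tau$, is constant along the leaves $\{x=\text{const}\}$). Consequently there is $\eta\in(0,1)$ such that $R$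 is Lipschitz on the partition elements with a uniform constant, $$|R|_\eta=\sup_{x\ne y,\ s(x,y)\ge1}\frac{|R(x)-R(y)|}{d_\eta(x,y)}<\infty,$$ and moreover $|\tilde F(x)-\tilde F(y)|\le B\,d_\eta(x,y)$ for all $x,y\in\bigcup\tilde{\mathcal Q}$. -/

import Mathlib

open Set

noncomputable section

/-- Parameters of the geometric neutral Lorenz flow without higher order terms: the coefficients
of the vector field near the origin, the expansion factor `a` of the return from the cusps to the
cross-section, and the flight time `τ₂` of that return with its Hölder exponent `ε`. -/
structure NeutralModel where
  a₀ : ℝ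
  a₂ : ℝ
  b₀ : ℝ
  b₂ : ℝ
  c₀ : ℝ
  c₂ : ℝ
  ℓ : ℝ
  a : ℝ
  τ₂ : ℝ → ℝ
  ε : ℝ
  a₀_pos : 0 < a₀
  a₂_pos : 0 < a₂
  b₀_pos : 0 < b₀
  b₂_pos : 0 < b₂
  c₀_nonneg : 0 ≤ c₀
  c₂_nonneg : 0 ≤ c₂
  ℓ_pos : 0 < ℓ
  Δ_ne : a₂ * b₀ - a₀ * b₂ ≠ 0
  -- the standing restrictions on `β₀ = (a₀ + b₀) / (2 a₀)` and `β₂ = (a₂ + b₂) / (2 b₂)`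
  β₀_gt : 1 / 2 < (a₀ + b₀) / (2 * a₀)
  β₀_lt : (a₀ + b₀) / (2 * a₀) < 2
  β₂_gt : 2 < (a₂ + b₂) / (2 * b₂)
  one_lt_a : 1 < a
  a_le_two : a ≤ 2
  ε_pos : 0 < ε
  ε_le_one : ε ≤ 1
  τ₂_pos : ∀ x ∈ Icc (-1 : ℝ) 1, x ≠ 0 → 0 < τ₂ x
  τ₂_holder : ∃ C : ℝ, ∀ x ∈ Icc (-1 : ℝ) 1, ∀ y ∈ Icc (-1 : ℝ) 1, 0 < x * y →
    |τ₂ x - τ₂ y| ≤ C * |x - y| ^ ε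

namespace NeutralModel

variable (M : NeutralModel)

/-- The neutral vector field at the point `(x, y, z)`. -/
def field (p : ℝ × ℝ × ℝ) : ℝ × ℝ × ℝ :=
  (p.1 * (M.a₀ * p.1 ^ 2 + M.a₂ * p.2.2 ^ 2),
   -M.ℓ * p.2.1 * (1 + M.c₀ * p.1 ^ 2 + M.c₂ * p.2.2 ^ 2),
   -p.2.2 * (M.b₀ * p.1 ^ 2 + M.b₂ * p.2.2 ^ 2))

/-- The orbit of the vector field that starts at the point `(x, y, 1)` of the plane `z = 1`, where
`p = (x, y)`, reaches the planes `x = ±1` for the first time at time `T`, at the point `q`.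
(For `|x| = 1` this time is `0`.) -/
def ExitsAt (p : ℝ × ℝ) (T : ℝ) (q : ℝ × ℝ × ℝ) : Prop :=
  0 ≤ T ∧ ∃ γ : ℝ → ℝ × ℝ × ℝ, γ 0 = (p.1, p.2, 1) ∧
    (∀ t ∈ Icc 0 T, HasDerivWithinAt γ (M.field (γ t)) (Icc 0 T) t) ∧
    (∀ t ∈ Ico 0 T, |(γ t).1| ≠ 1) ∧ |(γ T).1| = 1 ∧ γ T = q

/-- The flow time `τ'` from the cross-section to the cusps. -/
def exitTime (p : ℝ × ℝ) : ℝ :=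
  sInf {T : ℝ | ∃ q, M.ExitsAt p T q}

/-- The Dulac map `D₁`: the point at which the orbit of `(x, y, 1)` first reaches `x = ±1`
(unique for `0 < |x| ≤ 1`; an unused arbitrary value if there is none). -/
def dulac (p : ℝ × ℝ) : ℝ × ℝ × ℝ :=
  Classical.epsilon fun q => ∃ T, M.ExitsAt p T q

/-- The return map `P₂` from the cusps in `x = ±1` to the cross-section: rotation, expansion by
the factor `a` and translation. -/
def cuspReturn (q : ℝ × ℝ × ℝ) : ℝ × ℝ :=
  if 0 < q.1 then (M.a * q.2.2 - 1, q.2.1 - 1 / 2) else (1 - M.a * q.2.2, q.2.1 + 1 / 2)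

/-- The Poincaré map `P_Neu = P₂ ∘ D₁`, in the coordinates `(x, y)` of the plane `z = 1`. -/
def poincare (p : ℝ × ℝ) : ℝ × ℝ :=
  M.cuspReturn (M.dulac p)

/-- The return time `r_Neu = τ' + τ₂` of the Poincaré map. -/
def returnTime (p : ℝ × ℝ) : ℝ :=
  M.exitTime p + M.τ₂ p.1

/-- `r_Neu^{(k)}`, the sum of the first `k` return times. -/
def roofSum (k : ℕ) (p : ℝ × ℝ) : ℝ :=
  ∑ i ∈ Finset.range k, M.returnTime (M.poincare^[i] p)

/-- The one-dimensional Lorenz-like map `f_Neu` induced by the Poincaré map on the space of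
stable leaves `{x = const}`. -/
def lorenzMap (x : ℝ) : ℝ :=
  (M.poincare (x, 0)).1

end NeutralModel

/-- The `δ`-truncated distance from `x` to the singular point `0`. -/
def truncDist (δ x : ℝ) : ℝ :=
  if |x| < δ then |x| else 1

/-- `n` is a `(σ, δ)`-hyperbolic time, with recurrence exponent `c`, of the point `x` for the map
`f` with singular point `0`. -/
def IsHyperbolicTime (f : ℝ → ℝ) (σ c δ : ℝ) (n : ℕ) (x : ℝ) : Prop :=
  1 ≤ n ∧ ∀ k : ℕ, 1 ≤ k → k ≤ n →
    1 ≤ σ ^ k * ∏ j ∈ Finset.Ico (n - k) n, |deriv f (f^[j] x)| ∧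
    σ ^ (c * (k : ℝ)) ≤ truncDist δ (f^[n - k] x)

/-- An inducing scheme by hyperbolic times for a map `f` of `[-1, 1]` with singular point `0`:
an interval around `0` (the base), a countable partition of it modulo Lebesgue null sets into
intervals (the cells), and an inducing time `τ`, constant on cells, such that `f ^ τ` maps each
cell onto the base as a uniformly expanding `C²` diffeomorphism with bounded distortion. The
inducing time is a hyperbolic time `n` plus a transition time `m` that is bounded over all cells,
during which the orbit keeps a uniform distance from `0`. -/
structure InducingScheme (f : ℝ → ℝ) where
  left : ℝ
  right : ℝ
  neg_one_le_left : -1 ≤ left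
  left_neg : left < 0
  right_pos : 0 < right
  right_le_one : right ≤ 1
  cells : Set (Set ℝ)
  τ : ℝ → ℕ
  countable_cells : cells.Countable
  cell_interval : ∀ Q ∈ cells, ∃ u v : ℝ, u < v ∧ Q = Ioo u v ∧ Q ⊆ Ioo left right
  cells_disjoint : cells.PairwiseDisjoint id
  cells_cover : MeasureTheory.volume (Ioo left right \ ⋃₀ cells) = 0
  τ_const : ∀ Q ∈ cells, ∀ x ∈ Q, ∀ y ∈ Q, τ x = τ y
  full_branch : ∀ Q ∈ cells, BijOn (fun x => f^[τ x] x) Q (Ioo left right)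
  contDiffOn : ∀ Q ∈ cells, ContDiffOn ℝ 2 (fun x => f^[τ x] x) Q
  expanding : ∃ κ : ℝ, 1 < κ ∧ ∀ Q ∈ cells, ∀ x ∈ Q, κ ≤ |deriv (fun x => f^[τ x] x) x|
  distortion : ∃ K : ℝ, ∀ Q ∈ cells, ∀ x ∈ Q, ∀ y ∈ Q,
    |deriv (fun x => f^[τ x] x) x| ≤ K * |deriv (fun x => f^[τ x] x) y|
  hyperbolic : ∃ (σ c δ δ₀ : ℝ) (N : ℕ), 0 < σ ∧ σ < 1 ∧ 0 < c ∧ c ≤ 2 / 3 ∧ 0 < δ ∧ 0 < δ₀ ∧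
    ∀ Q ∈ cells, ∃ n m : ℕ, m ≤ N ∧ ∀ x ∈ Q, τ x = n + m ∧ IsHyperbolicTime f σ c δ n x ∧
      ∀ i : ℕ, n ≤ i → i < n + m → δ₀ ≤ |f^[i] x|

namespace InducingScheme

variable {f : ℝ → ℝ} (S : InducingScheme f)

/-- The induced map `F̃ = f ^ τ`. -/
def map (x : ℝ) : ℝ :=
  f^[S.τ x] x

/-- The domain of the induced map: the base up to a null set. -/
def domain : Set ℝ :=
  ⋃₀ S.cells

/-- The separation time: the least `n` such that the `n`-th iterates under the induced map do not
lie in a common cell; `⊤` if there is none. -/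
def sepTime (x y : ℝ) : ℕ∞ :=
  ⨅ (n : ℕ) (_ : ¬ ∃ Q ∈ S.cells, S.map^[n] x ∈ Q ∧ S.map^[n] y ∈ Q), (n : ℕ∞)

/-- The symbolic metric `d_η (x, y) = η ^ s (x, y)`. -/
def symbDist (η x y : ℝ) : ℝ :=
  if S.sepTime x y = ⊤ then 0 else η ^ (S.sepTime x y).toNat

/-- The best Lipschitz constant of `R` on the cells with respect to the symbolic metric. -/
def lipConst (η : ℝ) (R : ℝ → ℝ) : ENNReal :=
  ⨆ (x : ℝ) (y : ℝ) (_ : x ≠ y) (_ : 1 ≤ S.sepTime x y),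
    ENNReal.ofReal (|R x - R y| / S.symbDist η x y)

end InducingScheme

/-- The quotient induced roof function `R`, evaluated at the point of height `0` of each leaf. -/
def NeutralModel.inducedRoof (M : NeutralModel) (S : InducingScheme M.lorenzMap) (x : ℝ) : ℝ :=
  M.roofSum (S.τ x) (x, 0)

end

/-! With s = log (x² / z²) as parameter, the equations for x and z can be integrated explicitly: the
logarithmic derivative of x² with respect to s depends on s alone. The exit point and the flow time
thus become explicit functions of the initial x, and y plays no part in either. The flow time is
e^(`decay` s₀) times an increment of a bounded Lipschitz function of s. Since e^(`decay` s₀) is of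
order |x|^(-θ), with θ = 1/β₂ < 1/2, and d(log x²) costs a further 1/|x|, the flow times from x and
y differ by at most a multiple of r^(-(1+θ)) |x - y| if both points are at distance at least r from
0 (`exists_leafTime_sub_le`).

Let n be a hyperbolic time of a cell. At step i < n the distance to 0 is at least of order
σ^(c(n-i)), while the distance between two orbits is at most σ^(n-i) times their distance at time n
(`IsHyperbolicTime.abs_iterate_sub_le`). The flow-time differences are therefore of order
σ^((n-i)(1-(1+θ)c)), and the exponent is positive because c ≤ 2/3 and θ < 1/2. Those of `τ₂` are of
order σ^(ε(n-i)). Both sum geometrically. The bounded transition after n stays away from 0 and only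
changes constants (`exists_returnTime_iterate_sub_le`, `exists_roofSum_sub_le`). Expansion of the
induced map bounds the distance of its values by a power of κ⁻¹ given by the separation time, and
the Hölder exponent is absorbed by the choice η = κ^(-ε). -/

noncomputable section

namespace NeutralModel

variable (M : NeutralModel)

/-! ### Explicit integration in the parameter s = log (x² / z²) -/

/-- The logarithm of `x²` along an orbit, as a function of `s = log (x² / z²)`, up to a constant. -/
def growth (s : ℝ) : ℝ :=
  M.a₂ / (M.a₂ + M.b₂) * s + (M.a₀ / (M.a₀ + M.b₀) - M.a₂ / (M.a₂ + M.b₂)) *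
    Real.log ((M.a₀ + M.b₀) * Real.exp s + (M.a₂ + M.b₂))

/-- The derivative of `growth`. -/
def growthRate (s : ℝ) : ℝ :=
  (M.a₀ * Real.exp s + M.a₂) / ((M.a₀ + M.b₀) * Real.exp s + (M.a₂ + M.b₂))

/-- The logarithm of `z²` along an orbit, as a function of `s = log (x² / z²)`, up to a constant. -/
def decay (s : ℝ) : ℝ := M.growth s - s

/-- The derivative of the flow time with respect to `s = log (x² / z²)`, up to a constant factor. -/
def clockRate (s : ℝ) : ℝ :=
  Real.exp (-M.decay s) / (2 * ((M.a₀ + M.b₀) * Real.exp s + (M.a₂ + M.b₂)))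

/-- The flow time as a function of `s = log (x² / z²)`, up to an affine change. -/
def clock (s : ℝ) : ℝ := ∫ v in (0 : ℝ)..s, M.clockRate v

lemma denom_pos (s : ℝ) : 0 < (M.a₀ + M.b₀) * Real.exp s + (M.a₂ + M.b₂) := by
  have := M.a₀_pos; have := M.a₂_pos; have := M.b₀_pos; have := M.b₂_pos
  positivity

lemma hasDerivAt_growth (s : ℝ) : HasDerivAt M.growth (M.growthRate s) s := by
  have := M.a₀_pos; have := M.a₂_pos; have := M.b₀_pos; have := M.b₂_pos
  have hd := M.denom_pos s
  have h1 : HasDerivAt (fun s => (M.a₀ + M.b₀) * Real.exp s + (M.a₂ + M.b₂))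
      ((M.a₀ + M.b₀) * Real.exp s) s :=
    ((Real.hasDerivAt_exp s).const_mul _).add_const _
  have h2 := ((hasDerivAt_id s).const_mul (M.a₂ / (M.a₂ + M.b₂))).add
    ((h1.log hd.ne').const_mul (M.a₀ / (M.a₀ + M.b₀) - M.a₂ / (M.a₂ + M.b₂)))
  refine h2.congr_deriv ?_
  have hA : M.a₀ + M.b₀ ≠ 0 := by positivity
  have hC : M.a₂ + M.b₂ ≠ 0 := by positivity
  unfold growthRate
  field_simp
  ring

lemma hasDerivAt_decay (s : ℝ) : HasDerivAt M.decay (M.growthRate s - 1) s :=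
  (M.hasDerivAt_growth s).sub (hasDerivAt_id s)

lemma continuous_growth : Continuous M.growth :=
  continuous_iff_continuousAt.2 fun s => (M.hasDerivAt_growth s).continuousAt

lemma continuous_decay : Continuous M.decay :=
  M.continuous_growth.sub continuous_id

/-- A lower bound for the rates of `growth` and `-decay`. -/
lemma exists_growthRate_bounds :
    ∃ m : ℝ, 0 < m ∧ ∀ s, m ≤ M.growthRate s ∧ M.growthRate s ≤ 1 - m := by
  have ha0 := M.a₀_pos; have ha2 := M.a₂_pos; have hb0 := M.b₀_pos; have hb2 := M.b₂_pos
  have hA : 0 < M.a₀ + M.b₀ := by positivity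
  have hC : 0 < M.a₂ + M.b₂ := by positivity
  -- `growthRate` is a weighted mean of a₀/(a₀+b₀) and a₂/(a₂+b₂), and one minus it is the same mean
  -- of the complementary fractions.
  refine ⟨min (min (M.a₀ / (M.a₀ + M.b₀)) (M.a₂ / (M.a₂ + M.b₂)))
    (min (M.b₀ / (M.a₀ + M.b₀)) (M.b₂ / (M.a₂ + M.b₂))), by positivity, fun s => ?_⟩
  set m := min (min (M.a₀ / (M.a₀ + M.b₀)) (M.a₂ / (M.a₂ + M.b₂)))
    (min (M.b₀ / (M.a₀ + M.b₀)) (M.b₂ / (M.a₂ + M.b₂))) with hm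
  have h1 : m * (M.a₀ + M.b₀) ≤ M.a₀ := by
    rw [← le_div_iff₀ hA]; exact (min_le_left _ _).trans (min_le_left _ _)
  have h2 : m * (M.a₂ + M.b₂) ≤ M.a₂ := by
    rw [← le_div_iff₀ hC]; exact (min_le_left _ _).trans (min_le_right _ _)
  have h3 : m * (M.a₀ + M.b₀) ≤ M.b₀ := by
    rw [← le_div_iff₀ hA]; exact (min_le_right _ _).trans (min_le_left _ _)
  have h4 : m * (M.a₂ + M.b₂) ≤ M.b₂ := by
    rw [← le_div_iff₀ hC]; exact (min_le_right _ _).trans (min_le_right _ _)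
  have he := Real.exp_pos s
  unfold growthRate
  rw [le_div_iff₀ (M.denom_pos s), div_le_iff₀ (M.denom_pos s)]
  constructor
  · nlinarith [mul_le_mul_of_nonneg_right h1 he.le]
  · nlinarith [mul_le_mul_of_nonneg_right h3 he.le]

/-- A common lower bound for the rates of `growth` and `-decay`. -/
def rateBound : ℝ := M.exists_growthRate_bounds.choose

lemma rateBound_pos : 0 < M.rateBound := M.exists_growthRate_bounds.choose_spec.1

lemma rateBound_le (s : ℝ) : M.rateBound ≤ M.growthRate s :=
  (M.exists_growthRate_bounds.choose_spec.2 s).1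

lemma growthRate_le (s : ℝ) : M.growthRate s ≤ 1 - M.rateBound :=
  (M.exists_growthRate_bounds.choose_spec.2 s).2

lemma rateBound_mul_le_growth_sub {s t : ℝ} (h : s ≤ t) :
    M.rateBound * (t - s) ≤ M.growth t - M.growth s :=
  mul_sub_le_image_sub_of_le_deriv (fun x => (M.hasDerivAt_growth x).differentiableAt)
    (fun x => (M.hasDerivAt_growth x).deriv ▸ M.rateBound_le x) h

lemma growth_sub_le {s t : ℝ} (h : s ≤ t) :
    M.growth t - M.growth s ≤ (1 - M.rateBound) * (t - s) :=
  image_sub_le_mul_sub_of_deriv_le (fun x => (M.hasDerivAt_growth x).differentiableAt)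
    (fun x => (M.hasDerivAt_growth x).deriv ▸ M.growthRate_le x) h

lemma rateBound_mul_le_decay_sub {s t : ℝ} (h : s ≤ t) :
    M.rateBound * (t - s) ≤ M.decay s - M.decay t := by
  have := M.growth_sub_le h
  unfold decay
  linarith

lemma decay_sub_le {s t : ℝ} (h : s ≤ t) : M.decay s - M.decay t ≤ t - s := by
  have := M.rateBound_mul_le_growth_sub h
  have := mul_nonneg M.rateBound_pos.le (sub_nonneg.2 h)
  unfold decay
  linarith

lemma strictMono_growth : StrictMono M.growth := fun s t h => by
  have := M.rateBound_mul_le_growth_sub h.le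
  have := mul_pos M.rateBound_pos (sub_pos.2 h)
  linarith

lemma antitone_decay : Antitone M.decay := fun s t h => by
  have := M.rateBound_mul_le_decay_sub h
  have := mul_nonneg M.rateBound_pos.le (sub_nonneg.2 h)
  linarith

lemma surjective_growth : Function.Surjective M.growth := by
  have hm := M.rateBound_pos
  refine M.continuous_growth.surjective ?_ ?_
  · refine Filter.tendsto_atTop_mono' _ (f₁ := fun s => M.rateBound * s + M.growth 0) ?_
      (Filter.tendsto_atTop_add_const_right _ _ (Filter.tendsto_id.const_mul_atTop hm))
    filter_upwards [Filter.eventually_ge_atTop 0] with s hs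
    have := M.rateBound_mul_le_growth_sub hs
    simp only [sub_zero] at this
    linarith
  · refine Filter.tendsto_atBot_mono' _ (f₂ := M.growth)
      (f₁ := fun s => M.rateBound * s + M.growth 0) ?_
      (Filter.tendsto_atBot_add_const_right _ _ (Filter.tendsto_id.const_mul_atBot hm))
    filter_upwards [Filter.eventually_le_atBot 0] with s hs
    have := M.rateBound_mul_le_growth_sub hs
    simp only [zero_sub] at this
    linarith

/-- `growth` as an order isomorphism of the line. -/
def growthIso : ℝ ≃o ℝ := M.strictMono_growth.orderIsoOfSurjective _ M.surjective_growth

/-- The value of `s = log (x² / z²)` when the orbit starting with `s = s₀` and `z = 1` reaches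
`x² = 1`. -/
def exitParam (s₀ : ℝ) : ℝ := M.growthIso.symm (M.decay s₀)

lemma growth_exitParam (s₀ : ℝ) : M.growth (M.exitParam s₀) = M.decay s₀ :=
  M.growthIso.apply_symm_apply (M.decay s₀)

lemma continuous_exitParam : Continuous M.exitParam :=
  M.growthIso.symm.continuous.comp M.continuous_decay

lemma antitone_exitParam : Antitone M.exitParam := fun _ _ h =>
  M.growthIso.symm.monotone (M.antitone_decay h)

lemma exitParam_zero : M.exitParam 0 = 0 := by
  apply M.strictMono_growth.injective
  rw [growth_exitParam]
  simp [decay]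

/-- `growth` and `decay` are both bi-Lipschitz, hence so is the exit parameter. This upper bound
serves the flow time, and the lower bound below serves the one-dimensional map. -/
lemma exitParam_sub_le {s t : ℝ} (h : s ≤ t) :
    M.rateBound * (M.exitParam s - M.exitParam t) ≤ t - s := by
  have h1 := M.rateBound_mul_le_growth_sub (M.antitone_exitParam h)
  rw [growth_exitParam, growth_exitParam] at h1
  exact h1.trans (M.decay_sub_le h)

lemma le_exitParam_sub {s t : ℝ} (h : s ≤ t) :
    M.rateBound * (t - s) ≤ M.exitParam s - M.exitParam t := by
  have h1 := M.growth_sub_le (M.antitone_exitParam h)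
  rw [growth_exitParam, growth_exitParam] at h1
  have h2 := M.rateBound_mul_le_decay_sub h
  have := mul_nonneg M.rateBound_pos.le (sub_nonneg.2 (M.antitone_exitParam h))
  linarith

/-! ### The clock: boundedness and Lipschitz continuity -/

lemma clockRate_pos (s : ℝ) : 0 < M.clockRate s :=
  div_pos (Real.exp_pos _) (mul_pos two_pos (M.denom_pos s))

lemma continuous_clockRate : Continuous M.clockRate := by
  refine Continuous.div (Real.continuous_exp.comp M.continuous_decay.neg) (by fun_prop) fun s => ?_
  exact (mul_pos two_pos (M.denom_pos s)).ne'

lemma hasStrictDerivAt_clock (s : ℝ) : HasStrictDerivAt M.clock (M.clockRate s) s :=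
  M.continuous_clockRate.integral_hasStrictDerivAt 0 s

lemma hasDerivAt_clock (s : ℝ) : HasDerivAt M.clock (M.clockRate s) s :=
  (M.hasStrictDerivAt_clock s).hasDerivAt

lemma strictMono_clock : StrictMono M.clock :=
  strictMono_of_hasDerivAt_pos M.hasDerivAt_clock M.clockRate_pos

/-- Dropping the exponential term of the denominator gives a bound that is small as s → -∞. Dropping
the constant term instead gives the next lemma, effective as s → +∞. -/
lemma clockRate_le_decay (s : ℝ) :
    M.clockRate s ≤ Real.exp (-M.decay s) / (2 * (M.a₂ + M.b₂)) := by
  have := M.a₀_pos; have := M.a₂_pos; have := M.b₀_pos; have := M.b₂_pos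
  unfold clockRate
  refine div_le_div_of_nonneg_left (Real.exp_pos _).le (by positivity) ?_
  have : 0 ≤ (M.a₀ + M.b₀) * Real.exp s := by positivity
  linarith

lemma clockRate_le_growth (s : ℝ) :
    M.clockRate s ≤ Real.exp (-M.growth s) / (2 * (M.a₀ + M.b₀)) := by
  have := M.a₀_pos; have := M.a₂_pos; have := M.b₀_pos; have := M.b₂_pos
  have h : Real.exp (-M.growth s) / (2 * (M.a₀ + M.b₀)) =
      Real.exp (-M.decay s) / (2 * ((M.a₀ + M.b₀) * Real.exp s)) := by
    have : -M.decay s = -M.growth s + s := by unfold decay; ring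
    rw [this, Real.exp_add]
    field_simp
  rw [h]
  unfold clockRate
  gcongr
  linarith

lemma exists_clockRate_le : ∃ K : ℝ, 0 < K ∧ ∀ s, M.clockRate s ≤ K := by
  have := M.a₀_pos; have := M.a₂_pos; have := M.b₀_pos; have := M.b₂_pos
  refine ⟨Real.exp (-M.decay 0) / (2 * (M.a₂ + M.b₂)) +
    Real.exp (-M.growth 0) / (2 * (M.a₀ + M.b₀)), by positivity, fun s => ?_⟩
  rcases le_total s 0 with hs | hs
  · refine (M.clockRate_le_decay s).trans (le_add_of_le_of_nonneg ?_ (by positivity))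
    have := M.antitone_decay hs
    gcongr
  · refine (M.clockRate_le_growth s).trans (le_add_of_nonneg_of_le (by positivity) ?_)
    have := M.strictMono_growth.monotone hs
    gcongr

lemma exists_clock_sub_le : ∃ K : ℝ, 0 < K ∧ ∀ s t, |M.clock s - M.clock t| ≤ K * |s - t| := by
  obtain ⟨K, hK, h⟩ := M.exists_clockRate_le
  refine ⟨K, hK, fun s t => ?_⟩
  have := Convex.norm_image_sub_le_of_norm_hasDerivWithin_le (f := M.clock) (f' := M.clockRate)
    (C := K) (s := univ) (x := t) (y := s) (fun x _ => (M.hasDerivAt_clock x).hasDerivWithinAt)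
    (fun x _ => by rw [Real.norm_eq_abs, abs_of_pos (M.clockRate_pos x)]; exact h x) convex_univ
    (mem_univ _) (mem_univ _)
  simpa only [Real.norm_eq_abs] using this

/-- The rate decays exponentially at both ends. Instead of estimating integrals, the clock is
compared with multiples of e^(-`decay`) and e^(-`growth`); p and q are chosen so that their
derivatives dominate `clockRate`. -/
lemma exists_abs_clock_le : ∃ K : ℝ, 0 < K ∧ ∀ s, |M.clock s| ≤ K := by
  have := M.a₀_pos; have := M.a₂_pos; have := M.b₀_pos; have := M.b₂_pos
  have hm := M.rateBound_pos
  set p := 1 / (2 * (M.a₂ + M.b₂) * M.rateBound) with hp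
  set q := 1 / (2 * (M.a₀ + M.b₀) * M.rateBound) with hq
  have hp0 : 0 < p := by positivity
  have hq0 : 0 < q := by positivity
  have h0 : M.clock 0 = 0 := by simp [clock]
  have h1 : Monotone fun s => p * Real.exp (-M.decay s) - M.clock s := by
    refine monotone_of_hasDerivAt_nonneg
      (fun s => (((M.hasDerivAt_decay s).neg.exp).const_mul p).sub (M.hasDerivAt_clock s))
      fun s => sub_nonneg.2 ((M.clockRate_le_decay s).trans ?_)
    rw [div_le_iff₀ (by positivity)]
    change Real.exp (-M.decay s) ≤
      p * (Real.exp (-M.decay s) * -(M.growthRate s - 1)) * (2 * (M.a₂ + M.b₂))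
    have := M.growthRate_le s
    have he := Real.exp_pos (-M.decay s)
    have : p * (2 * (M.a₂ + M.b₂)) * M.rateBound = 1 := by rw [hp]; field_simp
    have h3 : p * (2 * (M.a₂ + M.b₂)) * M.rateBound ≤
      p * (2 * (M.a₂ + M.b₂)) * (-(M.growthRate s - 1)) := by gcongr; linarith
    nlinarith [mul_le_mul_of_nonneg_left h3 he.le]
  have h2 : Antitone fun s => q * Real.exp (-M.growth s) + M.clock s := by
    refine antitone_of_hasDerivAt_nonpos
      (fun s => (((M.hasDerivAt_growth s).neg.exp).const_mul q).add (M.hasDerivAt_clock s))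
      fun s => ?_
    have h4 := M.clockRate_le_growth s
    have := M.rateBound_le s
    have he := Real.exp_pos (-M.growth s)
    have : q * M.rateBound = 1 / (2 * (M.a₀ + M.b₀)) := by rw [hq]; field_simp
    have h3 : q * M.rateBound ≤ q * M.growthRate s := by gcongr
    rw [this] at h3
    rw [div_eq_mul_one_div] at h4
    have := mul_le_mul_of_nonneg_left h3 he.le
    change q * (Real.exp (-M.growth s) * -M.growthRate s) + M.clockRate s ≤ 0
    linarith
  refine ⟨p * Real.exp (-M.decay 0) + q * Real.exp (-M.growth 0), by positivity, fun s => ?_⟩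
  have hP : 0 < p * Real.exp (-M.decay 0) := by positivity
  have hQ : 0 < q * Real.exp (-M.growth 0) := by positivity
  rcases le_total s 0 with hs | hs
  · have h3 := h1 hs
    have h4 := M.strictMono_clock.monotone hs
    simp only [h0] at h3 h4
    have : 0 ≤ p * Real.exp (-M.decay s) := by positivity
    rw [abs_of_nonpos h4]; linarith
  · have h3 := h2 hs
    have h4 := M.strictMono_clock.monotone hs
    simp only [h0] at h3 h4
    have : 0 ≤ q * Real.exp (-M.growth s) := by positivity
    rw [abs_of_nonneg h4]; linarith

/-! ### Variation of the flow time and of the exit height -/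

/-- The flow time of the orbit starting with `x² = e ^ s₀` and `z = 1` up to the parameter `s`. -/
def orbitTime (s₀ s : ℝ) : ℝ := Real.exp (M.decay s₀) * (M.clock s - M.clock s₀)

/-- The total time is a product, so its variation splits in two: the exponential factor varies
against a bounded clock increment, and the clock increment varies in a Lipschitz way at both
endpoints. As `decay` is antitone, e^(`decay` s) bounds the factor in both terms. -/
lemma exists_orbitTime_sub_le : ∃ K : ℝ, 0 < K ∧ ∀ s t, s ≤ t →
    |M.orbitTime s (M.exitParam s) - M.orbitTime t (M.exitParam t)| ≤
      K * Real.exp (M.decay s) * (t - s) := by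
  obtain ⟨K, hK, hKb⟩ := M.exists_abs_clock_le
  obtain ⟨L, hL, hLb⟩ := M.exists_clock_sub_le
  have hm := M.rateBound_pos
  refine ⟨2 * K + L / M.rateBound + L, by positivity, fun s t hst => ?_⟩
  have hts : 0 ≤ t - s := sub_nonneg.2 hst
  have hE := M.antitone_decay hst
  have hsplit : M.orbitTime s (M.exitParam s) - M.orbitTime t (M.exitParam t) =
      (Real.exp (M.decay s) - Real.exp (M.decay t)) * (M.clock (M.exitParam s) - M.clock s) +
      Real.exp (M.decay t) * ((M.clock (M.exitParam s) - M.clock (M.exitParam t)) +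
        (M.clock t - M.clock s)) := by
    unfold orbitTime; ring
  have hexp : |Real.exp (M.decay s) - Real.exp (M.decay t)| ≤ Real.exp (M.decay s) * (t - s) := by
    rw [abs_of_nonneg (sub_nonneg.2 (Real.exp_le_exp.2 hE))]
    have h1 := Real.add_one_le_exp (M.decay t - M.decay s)
    have h2 : Real.exp (M.decay t) = Real.exp (M.decay s) * Real.exp (M.decay t - M.decay s) := by
      rw [← Real.exp_add]; congr 1; ring
    have h3 := M.decay_sub_le hst
    have h4 := mul_le_mul_of_nonneg_left h1 (Real.exp_pos (M.decay s)).le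
    have h5 := mul_le_mul_of_nonneg_left h3 (Real.exp_pos (M.decay s)).le
    nlinarith
  have h1 : |M.clock (M.exitParam s) - M.clock s| ≤ 2 * K := by
    have := abs_sub (M.clock (M.exitParam s)) (M.clock s)
    linarith [hKb (M.exitParam s), hKb s]
  have h2 : |M.clock (M.exitParam s) - M.clock (M.exitParam t)| ≤ L / M.rateBound * (t - s) := by
    refine (hLb _ _).trans ?_
    rw [abs_of_nonneg (sub_nonneg.2 (M.antitone_exitParam hst)), div_mul_eq_mul_div,
      le_div_iff₀ hm]
    have := mul_le_mul_of_nonneg_left (M.exitParam_sub_le hst) hL.le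
    linarith
  have h3 : |M.clock t - M.clock s| ≤ L * (t - s) := by
    simpa only [abs_of_nonneg hts] using hLb t s
  rw [hsplit]
  calc _ ≤ Real.exp (M.decay s) * (t - s) * (2 * K) +
        Real.exp (M.decay s) * (L / M.rateBound * (t - s) + L * (t - s)) := by
        refine (abs_add_le _ _).trans (add_le_add ?_ ?_)
        · rw [abs_mul]; gcongr
        · rw [abs_mul, Real.abs_exp]
          gcongr
          exact (abs_add_le _ _).trans (add_le_add h2 h3)
    _ = _ := by ring

/-- The exponent `1 / β₂` of the flow time near the singular point. -/
def timeExponent : ℝ := 2 * M.b₂ / (M.a₂ + M.b₂)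

lemma timeExponent_pos : 0 < M.timeExponent := by
  have := M.a₂_pos; have := M.b₂_pos
  unfold timeExponent; positivity

lemma timeExponent_lt : M.timeExponent < 1 / 2 := by
  have := M.a₂_pos; have := M.b₂_pos
  have h := M.β₂_gt
  rw [lt_div_iff₀ (by positivity)] at h
  unfold timeExponent
  rw [div_lt_iff₀ (by positivity)]
  linarith

/-- For x ≤ 1 the parameter is nonpositive, so the logarithmic term of `growth` is bounded. The
remaining linear term of `decay` is exactly -θ log x. -/
lemma exists_exp_decay_le : ∃ K : ℝ, 0 < K ∧ ∀ x : ℝ, 0 < x → x ≤ 1 →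
    Real.exp (M.decay (Real.log (x ^ 2))) ≤ K * x ^ (-M.timeExponent) := by
  have := M.a₀_pos; have := M.a₂_pos; have := M.b₀_pos; have := M.b₂_pos
  set k := M.a₀ / (M.a₀ + M.b₀) - M.a₂ / (M.a₂ + M.b₂) with hk
  set l := |Real.log (M.a₂ + M.b₂)| + |Real.log (M.a₀ + M.b₀ + (M.a₂ + M.b₂))| with hl
  refine ⟨Real.exp (|k| * l), Real.exp_pos _, fun x hx hx1 => ?_⟩
  rw [Real.rpow_def_of_pos hx, ← Real.exp_add]
  apply Real.exp_le_exp.2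
  have hs : Real.exp (Real.log (x ^ 2)) ≤ 1 := by
    rw [Real.exp_log (by positivity)]; nlinarith
  set s := Real.log (x ^ 2) with hsdef
  have h1 : Real.log (M.a₂ + M.b₂) ≤
      Real.log ((M.a₀ + M.b₀) * Real.exp s + (M.a₂ + M.b₂)) :=
    Real.log_le_log (by positivity) (le_add_of_nonneg_left (by positivity))
  have h2 : Real.log ((M.a₀ + M.b₀) * Real.exp s + (M.a₂ + M.b₂)) ≤
      Real.log (M.a₀ + M.b₀ + (M.a₂ + M.b₂)) := by
    apply Real.log_le_log (M.denom_pos s)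
    nlinarith
  have h3 : |Real.log ((M.a₀ + M.b₀) * Real.exp s + (M.a₂ + M.b₂))| ≤ l := by
    rw [abs_le]
    constructor
    · linarith [neg_abs_le (Real.log (M.a₂ + M.b₂)),
        abs_nonneg (Real.log (M.a₀ + M.b₀ + (M.a₂ + M.b₂)))]
    · linarith [abs_nonneg (Real.log (M.a₂ + M.b₂)),
        le_abs_self (Real.log (M.a₀ + M.b₀ + (M.a₂ + M.b₂)))]
  have h4 : M.decay s = k * Real.log ((M.a₀ + M.b₀) * Real.exp s + (M.a₂ + M.b₂)) +
      Real.log x * -M.timeExponent := by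
    have h5 : s = 2 * Real.log x := by rw [hsdef, Real.log_pow]; norm_num
    have hC : M.a₂ + M.b₂ ≠ 0 := by positivity
    have h6 : M.a₂ / (M.a₂ + M.b₂) * s - s = Real.log x * -M.timeExponent := by
      unfold timeExponent
      rw [h5]; field_simp; ring
    unfold decay growth
    rw [← h6]; ring
  rw [h4]
  refine add_le_add_left ((le_abs_self _).trans ?_) _
  rw [abs_mul]
  gcongr

/-- The exit time of the orbits that start in `z = 1` with first coordinate `x`. -/
def leafTime (x : ℝ) : ℝ :=
  M.orbitTime (Real.log (x ^ 2)) (M.exitParam (Real.log (x ^ 2)))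

/-- The last coordinate of the exit point of the orbits that start in `z = 1` with first
coordinate `x`. -/
def exitHeight (x : ℝ) : ℝ := Real.exp (-M.exitParam (Real.log (x ^ 2)) / 2)

lemma log_sq_sub_le {x y : ℝ} (hx : 0 < x) (hxy : x ≤ y) :
    Real.log (y ^ 2) - Real.log (x ^ 2) ≤ 2 * (y - x) / x := by
  have hy := hx.trans_le hxy
  have h1 := Real.log_le_sub_one_of_pos (div_pos hy hx)
  rw [Real.log_div hy.ne' hx.ne'] at h1
  rw [Real.log_pow, Real.log_pow]
  have : y / x - 1 = (y - x) / x := by field_simp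
  rw [this] at h1
  push_cast
  rw [mul_div_assoc]; linarith

lemma le_log_sq_sub {x y : ℝ} (hx : 0 < x) (hxy : x ≤ y) (hy1 : y ≤ 1) :
    y - x ≤ Real.log (y ^ 2) - Real.log (x ^ 2) := by
  have hy := hx.trans_le hxy
  have h1 := Real.log_le_sub_one_of_pos (div_pos hx hy)
  rw [Real.log_div hx.ne' hy.ne'] at h1
  rw [Real.log_pow, Real.log_pow]
  have h2 : y - x ≤ 1 - x / y := by
    rw [show 1 - x / y = (y - x) / y by field_simp, le_div_iff₀ hy]
    nlinarith
  push_cast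
  linarith

/-- The exponent combines x^(-θ) from the flow time with the factor 1/x from the derivative of log
x². -/
lemma exists_leafTime_sub_le : ∃ K : ℝ, 0 < K ∧ ∀ r x y : ℝ, 0 < r → r ≤ |x| → r ≤ |y| →
    |x| ≤ 1 → |y| ≤ 1 →
    |M.leafTime x - M.leafTime y| ≤ K * r ^ (-(1 + M.timeExponent)) * |x - y| := by
  obtain ⟨K, hK, h⟩ := M.exists_orbitTime_sub_le
  obtain ⟨L, hL, hL'⟩ := M.exists_exp_decay_le
  have key : ∀ r x y : ℝ, 0 < r → r ≤ x → x ≤ y → y ≤ 1 →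
      |M.leafTime x - M.leafTime y| ≤ (2 * K * L) * r ^ (-(1 + M.timeExponent)) * (y - x) := by
    intro r x y hr hrx hxy hy
    have hx := hr.trans_le hrx
    have h1 : Real.log (x ^ 2) ≤ Real.log (y ^ 2) :=
      Real.log_le_log (by positivity) (by gcongr)
    have h2 := h _ _ h1
    refine h2.trans ?_
    have h3 := log_sq_sub_le hx hxy
    have h4 := hL' x hx (hxy.trans hy)
    have h5 : x ^ (-(1 + M.timeExponent)) ≤ r ^ (-(1 + M.timeExponent)) :=
      Real.rpow_le_rpow_of_nonpos hr hrx (by linarith [M.timeExponent_pos])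
    have h6 : x ^ (-(1 + M.timeExponent)) = x⁻¹ * x ^ (-M.timeExponent) := by
      rw [neg_add, Real.rpow_add hx, Real.rpow_neg_one]
    have h7 : 0 ≤ y - x := sub_nonneg.2 hxy
    calc _ ≤ K * (L * x ^ (-M.timeExponent)) * (2 * (y - x) / x) := by gcongr
      _ = (2 * K * L) * x ^ (-(1 + M.timeExponent)) * (y - x) := by rw [h6]; field_simp
      _ ≤ _ := by gcongr
  have habs : ∀ x, M.leafTime |x| = M.leafTime x := fun x => by simp [leafTime, sq_abs]
  refine ⟨2 * K * L, by positivity, fun r x y hr hrx hry hx hy => ?_⟩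
  rw [← habs x, ← habs y]
  have hc : 0 ≤ (2 * K * L) * r ^ (-(1 + M.timeExponent)) := by positivity
  refine le_trans ?_ (mul_le_mul_of_nonneg_left (abs_abs_sub_abs_le x y) hc)
  rcases le_total |x| |y| with hxy | hxy
  · rw [abs_sub_comm |x|, abs_of_nonneg (sub_nonneg.2 hxy)]
    exact key r _ _ hr hrx hxy hy
  · rw [abs_sub_comm (M.leafTime _), abs_of_nonneg (sub_nonneg.2 hxy)]
    exact key r _ _ hr hry hxy hx

lemma exitHeight_pos (x : ℝ) : 0 < M.exitHeight x := Real.exp_pos _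

lemma exitParam_log_sq_nonneg {x : ℝ} (hx : x ≠ 0) (hx1 : |x| ≤ 1) :
    0 ≤ M.exitParam (Real.log (x ^ 2)) := by
  rw [← M.exitParam_zero]
  apply M.antitone_exitParam
  apply Real.log_nonpos (by positivity)
  rw [← sq_abs]
  exact pow_le_one₀ (abs_nonneg x) hx1

lemma exitHeight_le_one {x : ℝ} (hx : x ≠ 0) (hx1 : |x| ≤ 1) : M.exitHeight x ≤ 1 := by
  have := M.exitParam_log_sq_nonneg hx hx1
  apply Real.exp_le_one_iff.2
  linarith

lemma continuousOn_exitHeight : ContinuousOn M.exitHeight {0}ᶜ := by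
  intro x hx
  have hx : x ^ 2 ≠ 0 := pow_ne_zero 2 hx
  have h : ContinuousAt (fun x : ℝ => Real.log (x ^ 2)) x := by fun_prop (disch := assumption)
  have h2 := M.continuous_exitParam.continuousAt.comp h
  exact (Real.continuous_exp.continuousAt.comp (h2.neg.div_const 2)).continuousWithinAt

/-- Needed only away from the singular leaf, so the constant may depend on r; it need not exceed 1.
-/
lemma exists_le_exitHeight_sub {r : ℝ} (hr : 0 < r) : ∃ k : ℝ, 0 < k ∧ ∀ x y : ℝ, r ≤ |x| →
    r ≤ |y| → |x| ≤ 1 → |y| ≤ 1 → k * |(|x| - |y|)| ≤ |M.exitHeight x - M.exitHeight y| := by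
  have hm := M.rateBound_pos
  have key : ∀ x y : ℝ, r ≤ x → x ≤ y → y ≤ 1 → M.exitHeight r * M.rateBound / 2 * (y - x) ≤
      M.exitHeight y - M.exitHeight x := by
    intro x y hrx hxy hy
    have hx := hr.trans_le hrx
    have h1 : Real.log (x ^ 2) ≤ Real.log (y ^ 2) :=
      Real.log_le_log (by positivity) (by gcongr)
    have h0 : Real.log (r ^ 2) ≤ Real.log (x ^ 2) :=
      Real.log_le_log (by positivity) (by gcongr)
    have h2 := M.le_exitParam_sub h1
    have h3 := le_log_sq_sub hx hxy hy
    have h4 : M.exitHeight r ≤ M.exitHeight x := by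
      apply Real.exp_le_exp.2
      linarith [M.antitone_exitParam h0]
    have h5 : M.exitHeight y = M.exitHeight x * Real.exp
        ((M.exitParam (Real.log (x ^ 2)) - M.exitParam (Real.log (y ^ 2))) / 2) := by
      unfold exitHeight
      rw [← Real.exp_add]; congr 1; ring
    have h6 := Real.add_one_le_exp
      ((M.exitParam (Real.log (x ^ 2)) - M.exitParam (Real.log (y ^ 2))) / 2)
    have h7 : 0 ≤ y - x := sub_nonneg.2 hxy
    have h8 : M.rateBound * (y - x) ≤
      M.exitParam (Real.log (x ^ 2)) - M.exitParam (Real.log (y ^ 2)) := le_trans (by gcongr) h2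
    have h9 := M.exitHeight_pos x
    calc M.exitHeight r * M.rateBound / 2 * (y - x)
        = M.exitHeight r * (M.rateBound * (y - x) / 2) := by ring
      _ ≤ M.exitHeight x *
          ((M.exitParam (Real.log (x ^ 2)) - M.exitParam (Real.log (y ^ 2))) / 2) := by gcongr
      _ ≤ M.exitHeight y - M.exitHeight x := by
          rw [h5]
          nlinarith [mul_le_mul_of_nonneg_left h6 h9.le]
  have habs : ∀ x, M.exitHeight |x| = M.exitHeight x := fun x => by simp [exitHeight, sq_abs]
  refine ⟨M.exitHeight r * M.rateBound / 2, by have := M.exitHeight_pos r; positivity,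
    fun x y hrx hry hx hy => ?_⟩
  rw [← habs x, ← habs y]
  rcases le_total |x| |y| with hxy | hxy
  · rw [abs_sub_comm |x|, abs_sub_comm (M.exitHeight _), abs_of_nonneg (sub_nonneg.2 hxy)]
    exact (key _ _ hrx hxy hy).trans (le_abs_self _)
  · rw [abs_of_nonneg (sub_nonneg.2 hxy)]
    exact (key _ _ hry hxy hx).trans (le_abs_self _)

/-! ### The explicit curves are the orbits; uniqueness of the exit -/

/-- The derivative of `orbitTime`. -/
def orbitTimeRate (s₀ s : ℝ) : ℝ := Real.exp (M.decay s₀) * M.clockRate s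

lemma orbitTimeRate_pos (s₀ s : ℝ) : 0 < M.orbitTimeRate s₀ s :=
  mul_pos (Real.exp_pos _) (M.clockRate_pos s)

lemma continuous_orbitTimeRate (s₀ : ℝ) : Continuous (M.orbitTimeRate s₀) :=
  continuous_const.mul M.continuous_clockRate

lemma hasStrictDerivAt_orbitTime (s₀ s : ℝ) :
    HasStrictDerivAt (M.orbitTime s₀) (M.orbitTimeRate s₀ s) s :=
  HasStrictDerivAt.const_mul _ ((M.hasStrictDerivAt_clock s).sub_const _)

lemma strictMono_orbitTime (s₀ : ℝ) : StrictMono (M.orbitTime s₀) :=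
  strictMono_of_hasDerivAt_pos (fun s => (M.hasStrictDerivAt_orbitTime s₀ s).hasDerivAt)
    (M.orbitTimeRate_pos s₀)

lemma continuous_orbitTime (s₀ : ℝ) : Continuous (M.orbitTime s₀) :=
  continuous_iff_continuousAt.2 fun s => (M.hasStrictDerivAt_orbitTime s₀ s).hasDerivAt.continuousAt

/-- The first coordinate of the orbit of `(x, y, 1)` at the parameter `s`. -/
def orbitX (x s : ℝ) : ℝ := x * Real.exp ((M.growth s - M.growth (Real.log (x ^ 2))) / 2)

/-- The last coordinate of the orbit of `(x, y, 1)` at the parameter `s`. -/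
def orbitZ (x s : ℝ) : ℝ := Real.exp ((M.decay s - M.decay (Real.log (x ^ 2))) / 2)

/-- The contraction rate in the direction of `y` along the orbit of `(x, y, 1)`, with respect to
the parameter `s`. -/
def contractionRate (x s : ℝ) : ℝ :=
  M.ℓ * (1 + M.c₀ * M.orbitX x s ^ 2 + M.c₂ * M.orbitZ x s ^ 2) *
    M.orbitTimeRate (Real.log (x ^ 2)) s

/-- The orbit of `(x, y, 1)`, parametrized by `s = log (x² / z²)`. -/
def orbit (x y s : ℝ) : ℝ × ℝ × ℝ :=
  (M.orbitX x s, y * Real.exp (-∫ v in Real.log (x ^ 2)..s, M.contractionRate x v), M.orbitZ x s)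

/-- This confirms that s is log (x² / z²) along the curve, so the vector field can be written in
terms of s and z. -/
lemma orbitX_sq {x : ℝ} (hx : x ≠ 0) (s : ℝ) :
    M.orbitX x s ^ 2 = Real.exp s * M.orbitZ x s ^ 2 := by
  have h : x ^ 2 = Real.exp (Real.log (x ^ 2)) := (Real.exp_log (by positivity)).symm
  unfold orbitX orbitZ
  rw [mul_pow, ← Real.exp_nat_mul, ← Real.exp_nat_mul]
  nth_rewrite 1 [h]
  rw [← Real.exp_add, ← Real.exp_add]
  congr 1
  unfold decay
  push_cast
  ring

lemma orbitTimeRate_eq (x s : ℝ) : M.orbitTimeRate (Real.log (x ^ 2)) s =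
    1 / (2 * M.orbitZ x s ^ 2 * ((M.a₀ + M.b₀) * Real.exp s + (M.a₂ + M.b₂))) := by
  have h : Real.exp (M.decay (Real.log (x ^ 2))) * Real.exp (-M.decay s) =
      1 / M.orbitZ x s ^ 2 := by
    unfold orbitZ
    rw [← Real.exp_nat_mul, one_div, ← Real.exp_neg, ← Real.exp_add]
    congr 1
    push_cast
    ring
  unfold orbitTimeRate clockRate
  rw [← mul_div_assoc, h, div_div]
  congr 1
  ring

lemma hasDerivAt_orbit {x : ℝ} (hx : x ≠ 0) (y s : ℝ) :
    HasDerivAt (M.orbit x y) (M.orbitTimeRate (Real.log (x ^ 2)) s • M.field (M.orbit x y s)) s := by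
  have hd := M.denom_pos s
  have hz : 0 < M.orbitZ x s := Real.exp_pos _
  have hX : HasDerivAt (M.orbitX x) (M.orbitX x s * (M.growthRate s / 2)) s :=
    (((((M.hasDerivAt_growth s).sub_const _).div_const 2).exp).const_mul x).congr_deriv
      (by unfold orbitX; ring)
  have hZ : HasDerivAt (M.orbitZ x) (M.orbitZ x s * ((M.growthRate s - 1) / 2)) s :=
    ((((M.hasDerivAt_decay s).sub_const _).div_const 2).exp)
  have hcX : Continuous (M.orbitX x) := by
    have := M.continuous_growth
    unfold orbitX; fun_prop
  have hcZ : Continuous (M.orbitZ x) := by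
    have := M.continuous_decay
    unfold orbitZ; fun_prop
  have hcR : Continuous (M.contractionRate x) := by
    have := M.continuous_orbitTimeRate (Real.log (x ^ 2))
    unfold contractionRate; fun_prop
  have hY := ((hcR.integral_hasStrictDerivAt (Real.log (x ^ 2)) s).hasDerivAt.fun_neg.exp).const_mul y
  refine (hX.prodMk (hY.prodMk hZ)).congr_deriv ?_
  have hr := M.orbitTimeRate_eq x s
  refine Prod.ext ?_ (Prod.ext ?_ ?_)
  · simp only [orbit, field, Prod.smul_mk, smul_eq_mul]
    rw [hr, M.orbitX_sq hx s]
    unfold growthRate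
    field_simp
  · simp only [orbit, field, Prod.smul_mk, smul_eq_mul]
    unfold contractionRate
    ring
  · simp only [orbit, field, Prod.smul_mk, smul_eq_mul]
    rw [hr, M.orbitX_sq hx s]
    rw [show M.growthRate s - 1 = -(M.b₀ * Real.exp s + M.b₂) /
      ((M.a₀ + M.b₀) * Real.exp s + (M.a₂ + M.b₂)) by
        unfold growthRate; rw [eq_div_iff hd.ne', sub_mul, div_mul_cancel₀ _ hd.ne']; ring]
    field_simp

lemma orbit_log_sq (x y : ℝ) : M.orbit x y (Real.log (x ^ 2)) = (x, y, 1) := by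
  simp [orbit, orbitX, orbitZ]

/-- In this form, strict monotonicity of `growth` shows that |x| = 1 holds at the exit parameter and
not earlier. -/
lemma abs_orbitX {x : ℝ} (hx : x ≠ 0) (s : ℝ) : |M.orbitX x s| =
    Real.exp ((M.growth s - M.growth (M.exitParam (Real.log (x ^ 2)))) / 2) := by
  have h : |x| = Real.exp (Real.log (x ^ 2) / 2) := by
    rw [← sq_abs, Real.log_pow, Nat.cast_ofNat, mul_div_cancel_left₀ _ two_ne_zero,
      Real.exp_log (abs_pos.2 hx)]
  unfold orbitX
  rw [abs_mul, Real.abs_exp, h, ← Real.exp_add, growth_exitParam]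
  congr 1
  unfold decay
  ring

/-- The orbit of `(x, y, 1)` reaches `|x| = 1` at time `leafTime x`. -/
lemma exitsAt_orbit {x : ℝ} (hx : x ≠ 0) (hx1 : |x| ≤ 1) (y : ℝ) :
    M.ExitsAt (x, y) (M.leafTime x) (M.orbit x y (M.exitParam (Real.log (x ^ 2)))) := by
  have h0 : Real.log (x ^ 2) ≤ 0 := by
    apply Real.log_nonpos (by positivity)
    rw [← sq_abs]
    exact pow_le_one₀ (abs_nonneg x) hx1
  have h1 := M.exitParam_log_sq_nonneg hx hx1
  have hθ0 : M.orbitTime (Real.log (x ^ 2)) (Real.log (x ^ 2)) = 0 := by simp [orbitTime]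
  have hθ1 : M.orbitTime (Real.log (x ^ 2)) (M.exitParam (Real.log (x ^ 2))) = M.leafTime x := rfl
  have habs := M.abs_orbitX hx
  set s₀ := Real.log (x ^ 2) with hs₀
  set s₁ := M.exitParam s₀ with hs₁
  have hmono := M.strictMono_orbitTime s₀
  -- A left inverse is enough for the time change: every time in the interval considered is the
  -- `orbitTime` of some parameter.
  have hinv : Function.LeftInverse (Function.invFun (M.orbitTime s₀)) (M.orbitTime s₀) :=
    Function.leftInverse_invFun hmono.injective
  have hsurj : ∀ t ∈ Icc 0 (M.leafTime x), ∃ s ∈ Icc s₀ s₁, M.orbitTime s₀ s = t := by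
    intro t ht
    rw [← hθ0, ← hθ1] at ht
    exact intermediate_value_Icc (h0.trans h1) (M.continuous_orbitTime s₀).continuousOn ht
  refine ⟨?_, fun t => M.orbit x y (Function.invFun (M.orbitTime s₀) t), ?_, ?_, ?_, ?_, ?_⟩
  · rw [← hθ0, ← hθ1]
    exact hmono.monotone (h0.trans h1)
  · simp only
    rw [← hθ0, hinv, hs₀, orbit_log_sq]
  · intro t ht
    obtain ⟨s, hs, rfl⟩ := hsurj t ht
    have hg : HasDerivAt (Function.invFun (M.orbitTime s₀)) (M.orbitTimeRate s₀ s)⁻¹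
        (M.orbitTime s₀ s) :=
      ((M.hasStrictDerivAt_orbitTime s₀ s).to_local_left_inverse (M.orbitTimeRate_pos s₀ s).ne'
        (Filter.Eventually.of_forall hinv)).hasDerivAt
    have ho := M.hasDerivAt_orbit hx y (Function.invFun (M.orbitTime s₀) (M.orbitTime s₀ s))
    have := ho.scomp (M.orbitTime s₀ s) hg
    rw [hinv, ← hs₀, inv_smul_smul₀ (M.orbitTimeRate_pos s₀ s).ne'] at this
    simp only [hinv s]
    exact this.hasDerivWithinAt
  · intro t ht
    obtain ⟨s, hs, rfl⟩ := hsurj t (Ico_subset_Icc_self ht)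
    have hlt : s < s₁ := hmono.lt_iff_lt.1 (ht.2.trans_eq hθ1.symm)
    simp only [hinv s, orbit]
    rw [habs]
    refine (Real.exp_lt_exp.2 ?_).trans_eq Real.exp_zero |>.ne
    linarith [M.strictMono_growth hlt]
  · rw [← hθ1]
    simp only [hinv s₁, orbit]
    rw [habs]
    simp
  · rw [← hθ1]
    simp only [hinv s₁]

/-- Uniqueness of the exit time and the exit point. -/
lemma ExitsAt.unique {p : ℝ × ℝ} {T T' : ℝ} {q q' : ℝ × ℝ × ℝ} (h : M.ExitsAt p T q)
    (h' : M.ExitsAt p T' q') : T = T' ∧ q = q' := by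
  wlog hle : T ≤ T' generalizing T T' q q'
  · obtain ⟨h1, h2⟩ := this h' h (le_of_not_ge hle)
    exact ⟨h1.symm, h2.symm⟩
  obtain ⟨hT, γ, h0, hd, -, h1, rfl⟩ := h
  obtain ⟨-, γ', h0', hd', hne', -, rfl⟩ := h'
  have hc : ContinuousOn γ (Icc 0 T) := fun t ht => (hd t ht).continuousWithinAt
  have hc' : ContinuousOn γ' (Icc 0 T) := fun t ht =>
    ((hd' t ⟨ht.1, ht.2.trans hle⟩).continuousWithinAt).mono (Icc_subset_Icc_right hle)
  -- The cubic field is not globally Lipschitz, but both trajectories stay in a common ball, where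
  -- it is.
  obtain ⟨R, hR⟩ := ((isCompact_Icc.image_of_continuousOn hc).union
    (isCompact_Icc.image_of_continuousOn hc')).isBounded.subset_closedBall 0
  have hfield : ContDiff ℝ 1 M.field := by unfold field; fun_prop
  obtain ⟨K, hK⟩ := hfield.contDiffOn.exists_lipschitzOnWith one_ne_zero
    (convex_closedBall (0 : ℝ × ℝ × ℝ) R) (isCompact_closedBall _ _)
  have heq : EqOn γ γ' (Icc 0 T) := by
    refine ODE_solution_unique_of_mem_Icc_right (v := fun _ => M.field)
      (s := fun _ => Metric.closedBall 0 R) (fun _ _ => hK) hc ?_ ?_ hc' ?_ ?_ (h0.trans h0'.symm)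
    · exact fun t ht => (hd t (Ico_subset_Icc_self ht)).mono_of_mem_nhdsWithin
        (Icc_mem_nhdsGE_of_mem ht)
    · exact fun t ht => hR (Or.inl ⟨t, Ico_subset_Icc_self ht, rfl⟩)
    · exact fun t ht => (hd' t ⟨ht.1, ht.2.le.trans hle⟩).mono_of_mem_nhdsWithin
        (Icc_mem_nhdsGE_of_mem ⟨ht.1, ht.2.trans_le hle⟩)
    · exact fun t ht => hR (Or.inr ⟨t, Ico_subset_Icc_self ht, rfl⟩)
  have hTT := heq (right_mem_Icc.2 hT)
  rcases hle.lt_or_eq with hlt | rfl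
  · exact absurd (hTT ▸ h1) (hne' T ⟨hT, hlt⟩)
  · exact ⟨rfl, hTT⟩

lemma exitTime_eq {x : ℝ} (hx : x ≠ 0) (hx1 : |x| ≤ 1) (y : ℝ) :
    M.exitTime (x, y) = M.leafTime x := by
  have h := M.exitsAt_orbit hx hx1 y
  have : {T : ℝ | ∃ q, M.ExitsAt (x, y) T q} = {M.leafTime x} := by
    ext T
    constructor
    · rintro ⟨q, hq⟩
      exact (ExitsAt.unique M hq h).1
    · rintro rfl
      exact ⟨_, h⟩
  rw [exitTime, this, csInf_singleton]

lemma dulac_eq {x : ℝ} (hx : x ≠ 0) (hx1 : |x| ≤ 1) (y : ℝ) :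
    M.dulac (x, y) = M.orbit x y (M.exitParam (Real.log (x ^ 2))) := by
  have h := M.exitsAt_orbit hx hx1 y
  have h' : ∃ T, M.ExitsAt (x, y) T (M.dulac (x, y)) :=
    Classical.epsilon_spec (p := fun q => ∃ T, M.ExitsAt (x, y) T q) ⟨_, _, h⟩
  obtain ⟨T, hT⟩ := h'
  exact (ExitsAt.unique M hT h).2

lemma orbitZ_exitParam (x : ℝ) :
    M.orbitZ x (M.exitParam (Real.log (x ^ 2))) = M.exitHeight x := by
  unfold orbitZ exitHeight
  have h := M.growth_exitParam (Real.log (x ^ 2))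
  congr 1
  rw [← h, decay]
  ring

/-! ### The one-dimensional map -/

/-- The first coordinate of the Poincaré map does not depend on the height. -/
lemma poincare_fst {x : ℝ} (hx : x ≠ 0) (hx1 : |x| ≤ 1) (y : ℝ) :
    (M.poincare (x, y)).1 = if 0 < x then M.a * M.exitHeight x - 1 else 1 - M.a * M.exitHeight x := by
  have hpos : 0 < (M.orbit x y (M.exitParam (Real.log (x ^ 2)))).1 ↔ 0 < x :=
    mul_pos_iff_of_pos_right (Real.exp_pos _)
  have hz : (M.orbit x y (M.exitParam (Real.log (x ^ 2)))).2.2 = M.exitHeight x :=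
    M.orbitZ_exitParam x
  unfold poincare cuspReturn
  rw [dulac_eq M hx hx1, hz]
  simp only [hpos]
  split_ifs <;> rfl

lemma lorenzMap_eq {x : ℝ} (hx : x ≠ 0) (hx1 : |x| ≤ 1) :
    M.lorenzMap x = if 0 < x then M.a * M.exitHeight x - 1 else 1 - M.a * M.exitHeight x :=
  M.poincare_fst hx hx1 0

lemma poincare_fst_eq_lorenzMap {x : ℝ} (hx : x ≠ 0) (hx1 : |x| ≤ 1) (y : ℝ) :
    (M.poincare (x, y)).1 = M.lorenzMap x := by
  rw [M.poincare_fst hx hx1, M.lorenzMap_eq hx hx1]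

lemma abs_lorenzMap_le {x : ℝ} (hx : x ≠ 0) (hx1 : |x| ≤ 1) : |M.lorenzMap x| ≤ 1 := by
  have h0 := M.exitHeight_pos x
  have h1 := M.exitHeight_le_one hx hx1
  have h2 := M.one_lt_a
  have h3 := M.a_le_two
  rw [M.lorenzMap_eq hx hx1, abs_le]
  split_ifs <;> constructor <;> nlinarith

lemma continuousOn_lorenzMap : ContinuousOn M.lorenzMap (Icc (-1) 1 ∩ {0}ᶜ) := by
  have key : ContinuousOn (fun x => if 0 < x then M.a * M.exitHeight x - 1 else
      1 - M.a * M.exitHeight x) (Icc (-1) 1 ∩ {0}ᶜ) := by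
    have hc := M.continuousOn_exitHeight.mono (inter_subset_right (s := Icc (-1 : ℝ) 1))
    refine ContinuousOn.if' ?_ ?_ ?_ ?_
    · rintro x ⟨⟨-, hx0⟩, hx⟩
      rw [show {a : ℝ | 0 < a} = Ioi 0 from rfl, frontier_Ioi] at hx
      exact absurd hx hx0
    · rintro x ⟨⟨-, hx0⟩, hx⟩
      rw [show {a : ℝ | 0 < a} = Ioi 0 from rfl, frontier_Ioi] at hx
      exact absurd hx hx0
    · exact ((continuousOn_const.mul hc).sub continuousOn_const).mono inter_subset_left
    · exact (continuousOn_const.sub (continuousOn_const.mul hc)).mono inter_subset_left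
  exact key.congr fun x hx => M.lorenzMap_eq hx.2 (abs_le.2 hx.1)

lemma exists_le_lorenzMap_sub {r : ℝ} (hr : 0 < r) : ∃ k : ℝ, 0 < k ∧ ∀ x y : ℝ, r ≤ |x| →
    r ≤ |y| → |x| ≤ 1 → |y| ≤ 1 → 0 < x * y →
    k * |x - y| ≤ |M.lorenzMap x - M.lorenzMap y| := by
  obtain ⟨k, hk, h⟩ := M.exists_le_exitHeight_sub hr
  have ha : 1 < M.a := M.one_lt_a
  refine ⟨k, hk, fun x y hrx hry hx hy hxy => ?_⟩
  have hx0 : x ≠ 0 := left_ne_zero_of_mul hxy.ne'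
  have hy0 : y ≠ 0 := right_ne_zero_of_mul hxy.ne'
  have h1 : |(|x| - |y|)| = |x - y| ∧ |M.lorenzMap x - M.lorenzMap y| =
      M.a * |M.exitHeight x - M.exitHeight y| := by
    rw [M.lorenzMap_eq hx0 hx, M.lorenzMap_eq hy0 hy]
    rcases pos_and_pos_or_neg_and_neg_of_mul_pos hxy with ⟨hx', hy'⟩ | ⟨hx', hy'⟩
    · rw [abs_of_pos hx', abs_of_pos hy', if_pos hx', if_pos hy', ← abs_of_pos (zero_lt_one.trans ha),
        ← abs_mul, abs_of_pos (zero_lt_one.trans ha)]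
      exact ⟨rfl, by congr 1; ring⟩
    · rw [abs_of_neg hx', abs_of_neg hy', if_neg hx'.not_gt, if_neg hy'.not_gt,
        ← abs_of_pos (zero_lt_one.trans ha), ← abs_mul, abs_of_pos (zero_lt_one.trans ha)]
      exact ⟨by rw [abs_sub_comm]; congr 1; ring, by rw [abs_sub_comm]; congr 1; ring⟩
  rw [h1.2, ← h1.1]
  have h2 := h x y hrx hry hx hy
  nlinarith [abs_nonneg (M.exitHeight x - M.exitHeight y)]

end NeutralModel

/-! ### Hyperbolic times: backward contraction and slow recurrence -/

/-- The chain rule for iterates of a real function. -/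
lemma hasDerivAt_iterate_prod {f : ℝ → ℝ} {x : ℝ} {n : ℕ}
    (h : ∀ i < n, DifferentiableAt ℝ f (f^[i] x)) :
    HasDerivAt f^[n] (∏ i ∈ Finset.range n, deriv f (f^[i] x)) x := by
  induction n with
  | zero => simpa using hasDerivAt_id x
  | succ n ih =>
    rw [Function.iterate_succ', Finset.prod_range_succ, mul_comm]
    exact (h n n.lt_succ_self).hasDerivAt.comp x (ih fun i hi => h i (hi.trans n.lt_succ_self))

/-- A function whose derivative is at least `c > 0` in absolute value on an interval expands the
distances there by `c`. -/
lemma mul_abs_sub_le_of_le_abs_deriv {g : ℝ → ℝ} {J : Set ℝ} [hJ : J.OrdConnected] {c : ℝ}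
    (hc : 0 < c) (h : ∀ u ∈ J, c ≤ |deriv g u|) {a b : ℝ} (ha : a ∈ J) (hb : b ∈ J) :
    c * |a - b| ≤ |g a - g b| := by
  wlog hab : a < b generalizing a b
  · rcases (not_lt.1 hab).eq_or_lt with rfl | hlt
    · simp
    · rw [abs_sub_comm a, abs_sub_comm (g a)]
      exact this hb ha hlt
  have hd : ∀ u ∈ Icc a b, DifferentiableAt ℝ g u := fun u hu =>
    differentiableAt_of_deriv_ne_zero (abs_pos.1 (hc.trans_le (h u (hJ.out ha hb hu))))
  obtain ⟨u, hu, hu'⟩ := exists_deriv_eq_slope g hab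
    (fun u hu => (hd u hu).continuousAt.continuousWithinAt)
    (fun u hu => (hd u (Ioo_subset_Icc_self hu)).differentiableWithinAt)
  have h1 := h u (hJ.out ha hb (Ioo_subset_Icc_self hu))
  rw [hu', abs_div, le_div_iff₀ (abs_pos.2 (sub_pos.2 hab).ne')] at h1
  rwa [abs_sub_comm a, abs_sub_comm (g a)]

namespace IsHyperbolicTime

variable {f : ℝ → ℝ} {σ c δ : ℝ} {n : ℕ} {x : ℝ}

/-- `deriv` is 0 by default where the function is not differentiable, and the expansion condition
with k = n rules out a zero factor. -/
lemma differentiableAt (h : IsHyperbolicTime f σ c δ n x) {j : ℕ} (hj : j < n) :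
    DifferentiableAt ℝ f (f^[j] x) := by
  refine differentiableAt_of_deriv_ne_zero fun h0 => ?_
  have h1 := (h.2 n h.1 le_rfl).1
  rw [Finset.prod_eq_zero (i := j) (by simpa using hj) (by rw [h0, abs_zero]), mul_zero] at h1
  exact absurd h1 (by norm_num)

/-- The factor `min δ 1` covers the iterates outside the δ-neighbourhood, where the truncated
distance is 1 but only the lower bound δ is known. -/
lemma le_abs_iterate (h : IsHyperbolicTime f σ c δ n x) (hσ : 0 < σ) (hσ1 : σ < 1) (hc : 0 < c)
    (hδ : 0 < δ) {j : ℕ} (hj : j < n) :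
    min δ 1 * σ ^ (c * ((n - j : ℕ) : ℝ)) ≤ |f^[j] x| := by
  have h1 := (h.2 (n - j) (Nat.sub_pos_of_lt hj) (Nat.sub_le _ _)).2
  rw [Nat.sub_sub_self hj.le, truncDist] at h1
  have h2 : σ ^ (c * ((n - j : ℕ) : ℝ)) ≤ 1 := Real.rpow_le_one hσ.le hσ1.le (by positivity)
  have h3 : 0 < σ ^ (c * ((n - j : ℕ) : ℝ)) := by positivity
  have h4 : 0 < min δ 1 := by positivity
  split_ifs at h1 with h5
  · exact (mul_le_of_le_one_left h3.le (min_le_right _ _)).trans h1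
  · exact (mul_le_of_le_one_right h4.le h2).trans ((min_le_left _ _).trans (not_lt.1 h5))

/-- Backward contraction along an interval of points with a common hyperbolic time. -/
lemma abs_iterate_sub_le {Q : Set ℝ} (hQ : IsPreconnected Q) (hσ : 0 < σ)
    (h : ∀ x ∈ Q, IsHyperbolicTime f σ c δ n x) {j : ℕ} (hj : j ≤ n) {x y : ℝ} (hx : x ∈ Q)
    (hy : y ∈ Q) : |f^[j] x - f^[j] y| ≤ σ ^ (n - j) * |f^[n] x - f^[n] y| := by
  rcases hj.eq_or_lt with rfl | hjn
  · simp
  have hcont : ContinuousOn f^[j] Q := fun u hu =>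
    (hasDerivAt_iterate_prod fun i hi => (h u hu).differentiableAt
      (hi.trans hjn)).continuousAt.continuousWithinAt
  have : (f^[j] '' Q).OrdConnected := (hQ.image _ hcont).ordConnected
  have hσk : 0 < σ ^ (n - j) := by positivity
  -- The mean value argument runs on the j-th image of the cell, an interval on which the last n - j
  -- steps expand by at least σ^(-(n-j)).
  have hexp := mul_abs_sub_le_of_le_abs_deriv (g := f^[n - j]) (J := f^[j] '' Q)
    (inv_pos.2 hσk) ?_ (mem_image_of_mem _ hx) (mem_image_of_mem _ hy)
  · rw [← Function.iterate_add_apply, ← Function.iterate_add_apply, Nat.sub_add_cancel hj,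
      inv_mul_le_iff₀ hσk] at hexp
    exact hexp
  · rintro _ ⟨u, hu, rfl⟩
    have hd := hasDerivAt_iterate_prod (f := f) (x := f^[j] u) (n := n - j) fun i hi => by
      rw [← Function.iterate_add_apply]
      exact (h u hu).differentiableAt (by omega)
    have h1 := ((h u hu).2 (n - j) (by omega) (Nat.sub_le _ _)).1
    rw [Nat.sub_sub_self hj, Finset.prod_Ico_eq_prod_range, ← Finset.abs_prod] at h1
    rw [hd.deriv, inv_le_iff_one_le_mul₀' hσk]
    refine h1.trans_eq ?_
    congr 2
    refine Finset.prod_congr rfl fun i _ => ?_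
    rw [← Function.iterate_add_apply, add_comm]

end IsHyperbolicTime

/-- Truncated subtraction makes each term from index n on equal to 1; these are the transition
steps. -/
lemma sum_pow_tsub_le {r : ℝ} (h0 : 0 ≤ r) (h1 : r < 1) (n m : ℕ) :
    ∑ i ∈ Finset.range (n + m), r ^ (n - i) ≤ (1 - r)⁻¹ + m := by
  rw [Finset.sum_range_add]
  gcongr
  · calc ∑ i ∈ Finset.range n, r ^ (n - i) ≤ ∑ i ∈ Finset.range n, r ^ (n - 1 - i) :=
        Finset.sum_le_sum fun i hi => pow_le_pow_of_le_one h0 h1.le (by omega)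
      _ = ∑ i ∈ Finset.range n, r ^ i := Finset.sum_range_reflect (fun i => r ^ i) n
      _ ≤ ∑' i, r ^ i := (summable_geometric_of_lt_one h0 h1).sum_le_tsum _
        fun i _ => pow_nonneg h0 i
      _ = (1 - r)⁻¹ := tsum_geometric_of_lt_one h0 h1
  · calc ∑ i ∈ Finset.range m, r ^ (n - (n + i)) = ∑ i ∈ Finset.range m, (1 : ℝ) :=
        Finset.sum_congr rfl fun i _ => by simp
      _ ≤ m := by simp

/-! ### Iterates of the Poincaré map and the return time -/

namespace NeutralModel

variable (M : NeutralModel)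

lemma iterate_lorenzMap_mem {x : ℝ} (hx : x ∈ Icc (-1 : ℝ) 1) {n : ℕ}
    (h : ∀ i < n, M.lorenzMap^[i] x ≠ 0) : M.lorenzMap^[n] x ∈ Icc (-1 : ℝ) 1 := by
  induction n with
  | zero => exact hx
  | succ n ih =>
    have h1 := ih fun i hi => h i (hi.trans n.lt_succ_self)
    rw [Function.iterate_succ_apply']
    exact abs_le.1 (M.abs_lorenzMap_le (h n n.lt_succ_self) (abs_le.2 h1))

lemma iterate_poincare_fst {x : ℝ} (hx : x ∈ Icc (-1 : ℝ) 1) (u : ℝ) {n : ℕ}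
    (h : ∀ i < n, M.lorenzMap^[i] x ≠ 0) : (M.poincare^[n] (x, u)).1 = M.lorenzMap^[n] x := by
  induction n with
  | zero => rfl
  | succ n ih =>
    have h' : ∀ i < n, M.lorenzMap^[i] x ≠ 0 := fun i hi => h i (hi.trans n.lt_succ_self)
    have h1 := M.iterate_lorenzMap_mem hx h'
    have h2 := M.poincare_fst_eq_lorenzMap (h n n.lt_succ_self) (abs_le.2 h1)
      (M.poincare^[n] (x, u)).2
    rw [Function.iterate_succ_apply', Function.iterate_succ_apply', ← h2, ← ih h']

lemma continuousOn_iterate_lorenzMap {Q : Set ℝ} (hQ : Q ⊆ Icc (-1 : ℝ) 1) {n : ℕ}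
    (h : ∀ x ∈ Q, ∀ i < n, M.lorenzMap^[i] x ≠ 0) : ContinuousOn M.lorenzMap^[n] Q := by
  induction n with
  | zero => exact continuousOn_id
  | succ n ih =>
    have h' : ∀ x ∈ Q, ∀ i < n, M.lorenzMap^[i] x ≠ 0 :=
      fun x hx i hi => h x hx i (hi.trans n.lt_succ_self)
    rw [Function.iterate_succ']
    exact M.continuousOn_lorenzMap.comp (ih h') fun x hx =>
      ⟨M.iterate_lorenzMap_mem (hQ hx) (h' x hx), h x hx n n.lt_succ_self⟩

/-- The orbits of the points of an interval stay on the same side of `0` as long as they do not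
meet `0`. -/
lemma iterate_lorenzMap_mul_pos {Q : Set ℝ} (hQ : Q ⊆ Icc (-1 : ℝ) 1) (hQc : IsPreconnected Q)
    {n : ℕ} (h : ∀ x ∈ Q, ∀ i ≤ n, M.lorenzMap^[i] x ≠ 0) {x y : ℝ} (hx : x ∈ Q) (hy : y ∈ Q) :
    0 < M.lorenzMap^[n] x * M.lorenzMap^[n] y := by
  have hJ := (hQc.image _ (M.continuousOn_iterate_lorenzMap hQ
    fun x hx i hi => h x hx i hi.le)).ordConnected
  have h0 : (0 : ℝ) ∉ M.lorenzMap^[n] '' Q := by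
    rintro ⟨u, hu, hu0⟩
    exact h u hu n le_rfl hu0
  have hx' := mem_image_of_mem M.lorenzMap^[n] hx
  have hy' := mem_image_of_mem M.lorenzMap^[n] hy
  by_contra hneg
  rcases mul_nonpos_iff.1 (not_lt.1 hneg) with ⟨h1, h2⟩ | ⟨h1, h2⟩
  · exact h0 (hJ.out hy' hx' ⟨h2, h1⟩)
  · exact h0 (hJ.out hx' hy' ⟨h1, h2⟩)

/-- The variation of the return time between two points on the same side of the singular leaf. -/
lemma exists_returnTime_sub_le : ∃ K C : ℝ, 0 < K ∧ 0 ≤ C ∧ ∀ (r : ℝ) (p q : ℝ × ℝ), 0 < r →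
    r ≤ |p.1| → r ≤ |q.1| → |p.1| ≤ 1 → |q.1| ≤ 1 → 0 < p.1 * q.1 →
    |M.returnTime p - M.returnTime q| ≤
      K * r ^ (-(1 + M.timeExponent)) * |p.1 - q.1| + C * |p.1 - q.1| ^ M.ε := by
  obtain ⟨K, hK, hT⟩ := M.exists_leafTime_sub_le
  obtain ⟨C, hC⟩ := M.τ₂_holder
  refine ⟨K, |C|, hK, abs_nonneg C, fun r p q hr hrp hrq hp hq hpq => ?_⟩
  obtain ⟨x, u⟩ := p
  obtain ⟨y, v⟩ := q
  simp only at hrp hrq hp hq hpq ⊢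
  unfold returnTime
  rw [M.exitTime_eq (left_ne_zero_of_mul hpq.ne') hp, M.exitTime_eq (right_ne_zero_of_mul hpq.ne') hq,
    add_sub_add_comm]
  refine (abs_add_le _ _).trans (add_le_add (hT r x y hr hrp hrq hp hq) ?_)
  refine (hC x (abs_le.1 hp) y (abs_le.1 hq) hpq).trans ?_
  gcongr
  exact le_abs_self C

end NeutralModel

/-! ### Return times along the inducing time -/

namespace InducingScheme

lemma map_mem_base {f : ℝ → ℝ} (S : InducingScheme f) {Q : Set ℝ} (hQ : Q ∈ S.cells) {x : ℝ}
    (hx : x ∈ Q) : S.map x ∈ Ioo S.left S.right :=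
  (S.full_branch Q hQ).mapsTo hx

lemma abs_map_sub_le_two {f : ℝ → ℝ} (S : InducingScheme f) {x y : ℝ} (hx : x ∈ S.domain)
    (hy : y ∈ S.domain) : |S.map x - S.map y| ≤ 2 := by
  obtain ⟨Q, hQ, hx⟩ := hx
  obtain ⟨Q', hQ', hy⟩ := hy
  have h1 := S.map_mem_base hQ hx
  have h2 := S.map_mem_base hQ' hy
  have := S.neg_one_le_left
  have := S.right_le_one
  rw [abs_le]
  constructor <;> linarith [h1.1, h1.2, h2.1, h2.2]

variable {M : NeutralModel} (S : InducingScheme M.lorenzMap)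

/-- Along the inducing time, the return times of two points of a cell differ by an amount that
decays exponentially in the distance from the hyperbolic time. -/
lemma exists_returnTime_iterate_sub_le : ∃ (K r : ℝ) (N : ℕ), 0 < K ∧ 0 < r ∧ r < 1 ∧
    ∀ Q ∈ S.cells, ∃ n m : ℕ, m ≤ N ∧ ∀ x ∈ Q, S.τ x = n + m ∧ ∀ y ∈ Q, ∀ u v : ℝ,
      ∀ i < n + m, |M.returnTime (M.poincare^[i] (x, u)) - M.returnTime (M.poincare^[i] (y, v))| ≤
        K * r ^ (n - i) * |S.map x - S.map y| ^ M.ε := by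
  obtain ⟨σ, c, δ, δ₀, N, hσ, hσ1, hc, hc1, hδ, hδ₀, hcell⟩ := S.hyperbolic
  obtain ⟨K, C, hK, hC, hret⟩ := M.exists_returnTime_sub_le
  obtain ⟨k, hk, hexp⟩ := M.exists_le_lorenzMap_sub hδ₀
  have hθ := M.timeExponent_pos
  have hθ1 := M.timeExponent_lt
  have hε := M.ε_pos
  set θ := M.timeExponent with hθdef
  -- Capping at 1 makes the powers decreasing, so k'^N bounds them below for every transition time
  -- up to N.
  set k' := min k 1 with hk'
  have hk'0 : 0 < k' := by positivity
  have hk'1 : k' ≤ 1 := min_le_right _ _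
  set L := (k' ^ N)⁻¹ with hL
  have hL0 : 0 < L := by positivity
  set ρ := min (min δ 1) δ₀ with hρ
  have hρ0 : 0 < ρ := by positivity
  -- The decisive inequality: c ≤ 2/3 and θ < 1/2 give (1+θ)c < 1, so contraction beats the blow-up
  -- of the flow time.
  have hexpo : 0 < 1 - (1 + θ) * c := by nlinarith
  set r := max (σ ^ (1 - (1 + θ) * c)) (σ ^ M.ε) with hr
  have hr0 : 0 < r := lt_max_of_lt_right (by positivity)
  have hr1 : r < 1 := max_lt (Real.rpow_lt_one hσ.le hσ1 hexpo) (Real.rpow_lt_one hσ.le hσ1 hε)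
  refine ⟨K * ρ ^ (-(1 + θ)) * L * 2 + C * L ^ M.ε, r, N, by positivity, hr0, hr1,
    fun Q hQ => ?_⟩
  obtain ⟨n, m, hm, h⟩ := hcell Q hQ
  refine ⟨n, m, hm, fun x hx => ⟨(h x hx).1, fun y hy u v i hi => ?_⟩⟩
  have hQsub : Q ⊆ Icc (-1 : ℝ) 1 := by
    obtain ⟨_, _, -, -, hsub⟩ := S.cell_interval Q hQ
    exact fun z hz => ⟨S.neg_one_le_left.trans (hsub hz).1.le, (hsub hz).2.le.trans S.right_le_one⟩
  have hQc : IsPreconnected Q := by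
    obtain ⟨_, _, -, rfl, -⟩ := S.cell_interval Q hQ
    exact isPreconnected_Ioo
  have hlow : ∀ z ∈ Q, ∀ i < n + m, ρ * σ ^ (c * ((n - i : ℕ) : ℝ)) ≤ |M.lorenzMap^[i] z| := by
    intro z hz i hi
    rcases lt_or_ge i n with hin | hin
    · refine le_trans ?_ ((h z hz).2.1.le_abs_iterate hσ hσ1 hc hδ hin)
      gcongr
      exact min_le_left _ _
    · rw [Nat.sub_eq_zero_of_le hin, Nat.cast_zero, mul_zero, Real.rpow_zero, mul_one]
      exact (min_le_right _ _).trans ((h z hz).2.2 i hin hi)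
  have hne : ∀ z ∈ Q, ∀ i < n + m, M.lorenzMap^[i] z ≠ 0 := fun z hz i hi =>
    abs_pos.1 (lt_of_lt_of_le (by positivity) (hlow z hz i hi))
  have hmem : ∀ z ∈ Q, ∀ i < n + m, |M.lorenzMap^[i] z| ≤ 1 := fun z hz i hi =>
    abs_le.2 (M.iterate_lorenzMap_mem (hQsub hz) fun j hj => hne z hz j (hj.trans hi))
  have hsign : ∀ i < n + m, 0 < M.lorenzMap^[i] x * M.lorenzMap^[i] y := fun i hi =>
    M.iterate_lorenzMap_mul_pos hQsub hQc (fun z hz j hj => hne z hz j (hj.trans_lt hi)) hx hy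
  have hmap : ∀ z ∈ Q, S.map z = M.lorenzMap^[n + m] z := fun z hz => by
    unfold InducingScheme.map
    rw [(h z hz).1]
  set D := |S.map x - S.map y| with hD
  have hD0 : 0 ≤ D := abs_nonneg _
  -- This turns the linear estimate of the flow time into a Hölder one; it uses that the base has
  -- length at most 2.
  have hD2 : D ≤ 2 * D ^ M.ε := by
    have hDle : D ≤ 2 := S.abs_map_sub_le_two ⟨Q, hQ, hx⟩ ⟨Q, hQ, hy⟩
    rcases le_total D 1 with h1 | h1
    · have := Real.rpow_le_rpow_of_exponent_ge' hD0 h1 hε.le M.ε_le_one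
      rw [Real.rpow_one] at this
      linarith [Real.rpow_nonneg hD0 M.ε]
    · linarith [Real.one_le_rpow h1 hε.le]
  -- Induction backwards through the transition: one step back costs at most a factor 1/k', as the
  -- orbits stay δ₀ away from 0 on a common side.
  have htrans : ∀ j ≤ m, k' ^ j * |M.lorenzMap^[n + m - j] x - M.lorenzMap^[n + m - j] y| ≤ D := by
    intro j hj
    induction j with
    | zero => rw [hD, hmap x hx, hmap y hy]; simp
    | succ j ih =>
      refine le_trans ?_ (ih (by omega))
      obtain ⟨l, hl⟩ : ∃ l, n + m - (j + 1) = l := ⟨_, rfl⟩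
      have hl' : n + m - j = l + 1 := by omega
      have hlt : l < n + m := by omega
      have hnl : n ≤ l := by omega
      rw [hl, hl', pow_succ, mul_assoc, Function.iterate_succ_apply', Function.iterate_succ_apply']
      gcongr
      refine le_trans ?_ (hexp _ _ ((h x hx).2.2 l hnl hlt) ((h y hy).2.2 l hnl hlt)
        (hmem x hx l hlt) (hmem y hy l hlt) (hsign l hlt))
      gcongr
      exact min_le_left _ _
  have htrans' : ∀ l, n ≤ l → l ≤ n + m → |M.lorenzMap^[l] x - M.lorenzMap^[l] y| ≤ L * D := by
    intro l hnl hlm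
    have h1 := htrans (n + m - l) (by omega)
    rw [Nat.sub_sub_self hlm] at h1
    rw [hL, le_inv_mul_iff₀ (by positivity)]
    refine le_trans ?_ h1
    gcongr ?_ * _
    exact pow_le_pow_of_le_one hk'0.le hk'1 (by omega)
  have hdist : |M.lorenzMap^[i] x - M.lorenzMap^[i] y| ≤ σ ^ (n - i) * (L * D) := by
    rcases lt_or_ge i n with hin | hin
    · refine (IsHyperbolicTime.abs_iterate_sub_le hQc hσ (fun z hz => (h z hz).2.1) hin.le hx
        hy).trans ?_
      gcongr
      exact htrans' n le_rfl (Nat.le_add_right _ _)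
    · rw [Nat.sub_eq_zero_of_le hin, pow_zero, one_mul]
      exact htrans' i hin hi.le
  have hpx := M.iterate_poincare_fst (hQsub hx) u fun j hj => hne x hx j (hj.trans hi)
  have hpy := M.iterate_poincare_fst (hQsub hy) v fun j hj => hne y hy j (hj.trans hi)
  have hσi : 0 < σ ^ (c * ((n - i : ℕ) : ℝ)) := by positivity
  have hmain := hret (ρ * σ ^ (c * ((n - i : ℕ) : ℝ))) (M.poincare^[i] (x, u))
    (M.poincare^[i] (y, v)) (by positivity) (by rw [hpx]; exact hlow x hx i hi)
    (by rw [hpy]; exact hlow y hy i hi) (by rw [hpx]; exact hmem x hx i hi)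
    (by rw [hpy]; exact hmem y hy i hi) (by rw [hpx, hpy]; exact hsign i hi)
  rw [hpx, hpy] at hmain
  -- Singular blow-up and backward contraction combine into a single geometric rate.
  have hpow : (ρ * σ ^ (c * ((n - i : ℕ) : ℝ))) ^ (-(1 + θ)) * σ ^ (n - i) =
      ρ ^ (-(1 + θ)) * (σ ^ (1 - (1 + θ) * c)) ^ (n - i) := by
    rw [Real.mul_rpow hρ0.le hσi.le, ← Real.rpow_mul hσ.le, ← Real.rpow_natCast σ (n - i),
      ← Real.rpow_mul_natCast hσ.le, mul_assoc, ← Real.rpow_add hσ]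
    congr 2
    ring
  have hpow' : (σ ^ (n - i)) ^ M.ε = (σ ^ M.ε) ^ (n - i) := by
    rw [← Real.rpow_natCast_mul hσ.le, mul_comm, Real.rpow_mul_natCast hσ.le]
  refine hmain.trans ?_
  calc _ ≤ K * (ρ * σ ^ (c * ((n - i : ℕ) : ℝ))) ^ (-(1 + θ)) * (σ ^ (n - i) * (L * D)) +
        C * (σ ^ (n - i) * (L * D)) ^ M.ε := by gcongr
    _ = K * ((ρ * σ ^ (c * ((n - i : ℕ) : ℝ))) ^ (-(1 + θ)) * σ ^ (n - i)) * (L * D) +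
        C * ((σ ^ (n - i)) ^ M.ε * (L ^ M.ε * D ^ M.ε)) := by
        rw [Real.mul_rpow (x := σ ^ (n - i)) (by positivity) (by positivity),
          Real.mul_rpow hL0.le hD0]
        ring
    _ = K * (ρ ^ (-(1 + θ)) * (σ ^ (1 - (1 + θ) * c)) ^ (n - i)) * (L * D) +
        C * ((σ ^ M.ε) ^ (n - i) * (L ^ M.ε * D ^ M.ε)) := by rw [hpow, hpow']
    _ ≤ K * (ρ ^ (-(1 + θ)) * r ^ (n - i)) * (L * (2 * D ^ M.ε)) +
        C * (r ^ (n - i) * (L ^ M.ε * D ^ M.ε)) := by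
        gcongr
        · exact le_max_left _ _
        · exact le_max_right _ _
    _ = _ := by ring

lemma exists_roofSum_sub_le : ∃ B : ℝ, 0 < B ∧ ∀ Q ∈ S.cells, ∀ x ∈ Q, ∀ y ∈ Q, ∀ u v : ℝ,
    ∀ k ≤ S.τ x, |M.roofSum k (x, u) - M.roofSum k (y, v)| ≤ B * |S.map x - S.map y| ^ M.ε := by
  obtain ⟨K, r, N, hK, hr0, hr1, h⟩ := S.exists_returnTime_iterate_sub_le
  have h1r : 0 < 1 - r := sub_pos.2 hr1
  refine ⟨K * ((1 - r)⁻¹ + N), by positivity, fun Q hQ x hx y hy u v k hk => ?_⟩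
  obtain ⟨n, m, hm, hcell⟩ := h Q hQ
  obtain ⟨hτ, hterm⟩ := hcell x hx
  rw [hτ] at hk
  unfold NeutralModel.roofSum
  rw [← Finset.sum_sub_distrib]
  calc _ ≤ ∑ i ∈ Finset.range k,
        |M.returnTime (M.poincare^[i] (x, u)) - M.returnTime (M.poincare^[i] (y, v))| :=
        Finset.abs_sum_le_sum_abs _ _
    _ ≤ ∑ i ∈ Finset.range (n + m),
        |M.returnTime (M.poincare^[i] (x, u)) - M.returnTime (M.poincare^[i] (y, v))| :=
        Finset.sum_le_sum_of_subset_of_nonneg (Finset.range_subset_range.2 hk)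
          fun _ _ _ => abs_nonneg _
    _ ≤ ∑ i ∈ Finset.range (n + m), K * r ^ (n - i) * |S.map x - S.map y| ^ M.ε :=
        Finset.sum_le_sum fun i hi => hterm y hy u v i (Finset.mem_range.1 hi)
    _ = K * (∑ i ∈ Finset.range (n + m), r ^ (n - i)) * |S.map x - S.map y| ^ M.ε := by
        rw [Finset.mul_sum, Finset.sum_mul]
    _ ≤ _ := by
        have := sum_pow_tsub_le hr0.le hr1 n m
        have hmN : (m : ℝ) ≤ N := by exact_mod_cast hm
        gcongr
        linarith

end InducingScheme

/-! ### The symbolic metric -/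

namespace InducingScheme

variable {f : ℝ → ℝ} (S : InducingScheme f)

lemma exists_mem_cell_of_lt_sepTime {x y : ℝ} {n : ℕ} (h : (n : ℕ∞) < S.sepTime x y) :
    ∃ Q ∈ S.cells, S.map^[n] x ∈ Q ∧ S.map^[n] y ∈ Q := by
  by_contra hn
  exact absurd h (not_lt.2 (iInf₂_le n hn))

lemma symbDist_nonneg {η : ℝ} (h : 0 ≤ η) (x y : ℝ) : 0 ≤ S.symbDist η x y := by
  unfold symbDist
  split_ifs
  · exact le_rfl
  · positivity

lemma symbDist_mono {η η' : ℝ} (h : 0 ≤ η) (h' : η ≤ η') (x y : ℝ) :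
    S.symbDist η x y ≤ S.symbDist η' x y := by
  unfold symbDist
  split_ifs
  · exact le_rfl
  · gcongr

/-- A Hölder bound for one parameter becomes a Lipschitz bound for another. -/
lemma symbDist_rpow {η : ℝ} (h : 0 ≤ η) {e : ℝ} (he : 0 < e) (x y : ℝ) :
    S.symbDist η x y ^ e = S.symbDist (η ^ e) x y := by
  unfold symbDist
  split_ifs
  · exact Real.zero_rpow he.ne'
  · rw [← Real.rpow_natCast_mul h, mul_comm, Real.rpow_mul_natCast h]

/-- The induced map is Lipschitz on its domain with respect to the symbolic metric whose parameter
is the inverse of its expansion factor. -/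
lemma exists_abs_map_sub_le_symbDist : ∃ κ : ℝ, 1 < κ ∧ ∀ x ∈ S.domain, ∀ y ∈ S.domain,
    |S.map x - S.map y| ≤ 2 * κ * S.symbDist κ⁻¹ x y := by
  obtain ⟨κ, hκ, hexp⟩ := S.expanding
  have hκ0 : 0 < κ := zero_lt_one.trans hκ
  have hstep : ∀ Q ∈ S.cells, ∀ u ∈ Q, ∀ v ∈ Q, κ * |u - v| ≤ |S.map u - S.map v| := by
    intro Q hQ u hu v hv
    have : Q.OrdConnected := by
      obtain ⟨_, _, -, rfl, -⟩ := S.cell_interval Q hQ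
      exact ordConnected_Ioo
    exact mul_abs_sub_le_of_le_abs_deriv (g := S.map) hκ0 (hexp Q hQ) hu hv
  refine ⟨κ, hκ, fun x hx y hy => ?_⟩
  -- The comparison starts from the first images, so a separation time n + 1 yields only n
  -- expansions; this is where the factor κ in 2κ comes from.
  have hiter : ∀ n : ℕ, ((n + 1 : ℕ) : ℕ∞) ≤ S.sepTime x y →
      κ ^ n * |S.map x - S.map y| ≤ |S.map^[n + 1] x - S.map^[n + 1] y| := by
    intro n
    induction n with
    | zero => intro _; simp
    | succ n ih =>
      intro hn
      obtain ⟨Q, hQ, hxQ, hyQ⟩ := S.exists_mem_cell_of_lt_sepTime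
        (lt_of_lt_of_le (by exact_mod_cast (n + 1).lt_succ_self) hn)
      have h1 := ih (le_trans (by exact_mod_cast (n + 1).le_succ) hn)
      have h2 := hstep Q hQ _ hxQ _ hyQ
      rw [Function.iterate_succ_apply' _ (n + 1), Function.iterate_succ_apply' _ (n + 1)]
      refine le_trans ?_ h2
      rw [pow_succ', mul_assoc]
      gcongr
  have hiter2 : ∀ n : ℕ, ((n + 1 : ℕ) : ℕ∞) ≤ S.sepTime x y →
      κ ^ n * |S.map x - S.map y| ≤ 2 := by
    intro n hn
    obtain ⟨Q, hQ, hxQ, hyQ⟩ := S.exists_mem_cell_of_lt_sepTime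
      (lt_of_lt_of_le (by exact_mod_cast n.lt_succ_self) hn)
    refine (hiter n hn).trans ?_
    rw [Function.iterate_succ_apply', Function.iterate_succ_apply']
    exact S.abs_map_sub_le_two ⟨Q, hQ, hxQ⟩ ⟨Q, hQ, hyQ⟩
  unfold symbDist
  split_ifs with htop
  · rw [mul_zero]
    by_contra! hpos
    obtain ⟨n, hn⟩ := pow_unbounded_of_one_lt (2 / |S.map x - S.map y|) hκ
    rw [div_lt_iff₀ hpos] at hn
    exact absurd (hiter2 n (htop ▸ le_top)) (not_le.2 hn)
  · obtain ⟨t, ht⟩ := ENat.ne_top_iff_exists.1 htop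
    rw [← ht, ENat.toNat_natCast]
    rcases t with _ | t
    · rw [pow_zero, mul_one]
      linarith [S.abs_map_sub_le_two hx hy]
    · have h1 := hiter2 t ht.le
      rw [inv_pow, ← div_eq_mul_inv, le_div_iff₀ (by positivity), pow_succ]
      nlinarith

end InducingScheme
end

theorem mainTheorem4 (M : NeutralModel) (S : InducingScheme M.lorenzMap) :
    ∃ B : ℝ, 0 < B ∧
      (∀ x y : ℝ, 1 ≤ S.sepTime x y →
        ∀ u ∈ Set.Icc (-1 : ℝ) 1, ∀ v ∈ Set.Icc (-1 : ℝ) 1, ∀ k : ℕ, k ≤ S.τ x →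
          |M.roofSum k (x, u) - M.roofSum k (y, v)| ≤ B * |S.map x - S.map y| ^ M.ε) ∧
      ∃ η : ℝ, 0 < η ∧ η < 1 ∧
        S.lipConst η (M.inducedRoof S) < ⊤ ∧
        ∀ x ∈ S.domain, ∀ y ∈ S.domain, |S.map x - S.map y| ≤ B * S.symbDist η x y := by
  obtain ⟨B, hB, hroof⟩ := S.exists_roofSum_sub_le
  obtain ⟨κ, hκ, hmap⟩ := S.exists_abs_map_sub_le_symbDist
  have hκ0 : 0 < κ := zero_lt_one.trans hκ
  have hκi : κ⁻¹ < 1 := inv_lt_one_of_one_lt₀ hκ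
  have hε := M.ε_pos
  have hcell : ∀ x y : ℝ, 1 ≤ S.sepTime x y → ∃ Q ∈ S.cells, x ∈ Q ∧ y ∈ Q := fun x y h =>
    S.exists_mem_cell_of_lt_sepTime (n := 0) (lt_of_lt_of_le (by simp) h)
  -- The ε-th power of the bound 2κ·d, with d the metric for κ⁻¹, gives the Lipschitz bound for the
  -- roof with η = κ^(-ε). Since ε ≤ 1, this η is at least κ⁻¹ and also serves the induced map.
  refine ⟨max B (2 * κ), lt_max_of_lt_left hB, ?_, κ⁻¹ ^ M.ε, by positivity,
    Real.rpow_lt_one (by positivity) hκi hε, ?_, ?_⟩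
  · intro x y hxy u _ v _ k hk
    obtain ⟨Q, hQ, hx, hy⟩ := hcell x y hxy
    refine (hroof Q hQ x hx y hy u v k hk).trans ?_
    gcongr
    exact le_max_left _ _
  · refine lt_of_le_of_lt ?_ (ENNReal.ofReal_lt_top (r := B * (2 * κ) ^ M.ε))
    refine iSup_le fun x => iSup_le fun y => iSup_le fun _ => iSup_le fun hxy => ?_
    obtain ⟨Q, hQ, hx, hy⟩ := hcell x y hxy
    -- If the points never separate, the quotient is 0 by the convention for division. The product
    -- inequality still holds there and gives equal roofs.
    refine ENNReal.ofReal_le_ofReal (div_le_of_le_mul₀ (S.symbDist_nonneg (by positivity) x y)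
      (by positivity) ?_)
    have h1 := hroof Q hQ x hx y hy 0 0 (S.τ x) le_rfl
    have h2 := hmap x ⟨Q, hQ, hx⟩ y ⟨Q, hQ, hy⟩
    have h3 := S.symbDist_nonneg (inv_nonneg.2 hκ0.le) x y
    unfold NeutralModel.inducedRoof
    rw [← S.τ_const Q hQ x hx y hy, ← S.symbDist_rpow (inv_nonneg.2 hκ0.le) hε, mul_assoc,
      ← Real.mul_rpow (by positivity) h3]
    refine h1.trans ?_
    gcongr
  · intro x hx y hy
    refine (hmap x hx y hy).trans ?_
    have hle : κ⁻¹ ≤ κ⁻¹ ^ M.ε := by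
      have := Real.rpow_le_rpow_of_exponent_ge (by positivity) hκi.le M.ε_le_one
      rwa [Real.rpow_one] at this
    have h3 := S.symbDist_nonneg (inv_nonneg.2 hκ0.le) x y
    gcongr
    · exact le_max_right _ _
    · exact S.symbDist_mono (by positivity) hle x y
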